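/- **Notation.** Let $n\ge 1$ and let $\mathbb H^n=\mathbb C^n\times\mathbb R$ be the Heisenberg group with the law $(z,t)(w,s)=(z+w,\,t+s+\tfrac12\operatorname{Im}(z\cdot\bar w))$, Lebesgue measure $dz\,dt$, homogeneous dimension $Q=2n+2$ and Korányi norm $|(z,t)|=(|z|^4+t^2)^{1/4}$. For $\lambda\in\mathbb R\setminus\{0\}$ and $k=0,1,2,\dots$ put $$e_{k,\lambda}(z,t)=e^{i\lambda t}\,L_k^{n-1}\!\left(\tfrac12|\lambda||z|^2\right)e^{-\frac14|\lambda||z|^2},\qquad c_{n,k}=\frac{k!\,(n-1)!}{(k+n-1)!},$$ where $L_k^{n-1}$ is the Laguerre polynomial of degree $k$ and type $n-1$. The Heisenberg fan is $\Omega=\bigcup_{k\ge 0}R_k\cup R_\infty\subset\mathbb R^2$ with $R_k=\{(\lambda,(2k+n)|\lambda|):\lambda\ne 0\}$ and $R_\infty=\{(0,\tau):\tau\ge 0\}$, and it carries the measure $\nu_2$ given by $$\int_\Omega\phi\,d\nu_2=(2\pi)^{-2n-1}\int_{\mathbb R}\sum_{k=0}^\infty c_{n,k}^{-2}\,\phi(\lambda,(2k+n)|\lambda|)\,|\lambda|^{2n}\,d\lambda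 .$$ For $f\in L^1(\mathbb H^n)$ the normalized Strichartz Fourier transform $\mathcal F f$ on $\Omega\times\mathbb C^n$ is $$\mathcal F f(a,w)=c_{n,k}\int_{\mathbb H^n}f(z,t)\,e_{k,\lambda}\big((z,t)^{-1}(w,0)\big)\,dz\,dt,\qquad a=(\lambda,(2k+n)|\lambda|)\in R_k,$$ and on the $\nu_2$-null ray $R_\infty$ $$\mathcal F f((0,\tau),w)=2^{n-1}(n-1)!\int_{\mathbb H^n}f(z,t)\,\frac{J_{n-1}(\sqrt\tau|w-z|)}{(\sqrt\tau|w-z|)^{n-1}}\,dz\,dt ,$$ where $J_{n-1}$ is the Bessel function and the quotient has its limiting value where $\sqrt\tau|w-z|=0$. **Theorem.** Let $n\ge1$ and $0<\alpha<Q/2$. The transform $\mathcal F$ extends uniquely from $L^1\cap L^2(\mathbb H^n)$ to a bounded linear operator $\mathcal F:L^2(\mathbb H^n)\to L^2(\Omega\times\mathbb C^n,d\nu_2\,dw)$, and there is a constant $C>0$ depending only on $n$ and $\alpha$ such that, for every $E\subseteq\Omega\times\mathbb C^n$ and every $f\in L^2(\mathbb H^n)$, $$\int_E|\mathcal F f(a,w)|^2\,d\nu_2(a)\,dw\;\le\;C\,|E|^{2\alpha/Q}\,\big\|\,|(z,t)|^\alpha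 f\,\big\|_2^2 ,$$ where $|E|$ is the $d\nu_2\,dw$-measure of $E$, both sides may be $+\infty$, and $0\cdot\infty=0$. -/

import Mathlib

open MeasureTheory
open scoped ENNReal Nat

noncomputable section

namespace Heisenberg

/-- The underlying space `ℂⁿ`. The measure `volume` is Lebesgue measure `dx dy` on `ℝ²ⁿ`.
The Euclidean length of a vector is `cnorm` below; the sup norm that Lean puts on this type
is never used. -/
abbrev Cn (n : ℕ) : Type := Fin n → ℂ

/-- The Euclidean length `|z| = (∑ |z_j|²)^{1/2}` on `ℂⁿ`. -/
def cnorm {n : ℕ} (z : Cn n) : ℝ := √(∑ j, ‖z j‖ ^ 2)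

/-- The space `ℍⁿ = ℂⁿ × ℝ`; `volume` is Lebesgue measure `dz dt`. Its group law is `mul`. -/
abbrev Hn (n : ℕ) : Type := Cn n × ℝ

/-- The group law `(z,t)(w,s) = (z + w, t + s + ½ Im (z · w̄))`. -/
def mul {n : ℕ} (p q : Hn n) : Hn n :=
  (p.1 + q.1, p.2 + q.2 + (∑ j, p.1 j * (starRingEnd ℂ) (q.1 j)).im / 2)

/-- The group inverse `(z,t)⁻¹ = (-z,-t)`. -/
def inv {n : ℕ} (p : Hn n) : Hn n := (-p.1, -p.2)

/-- The Korányi norm `|(z,t)| = (|z|⁴ + t²)^{1/4}`. -/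
def koranyi {n : ℕ} (p : Hn n) : ℝ := (cnorm p.1 ^ 4 + p.2 ^ 2) ^ (1 / 4 : ℝ)

/-- The homogeneous dimension `Q = 2n + 2`. -/
def homDim (n : ℕ) : ℝ := 2 * n + 2

/-- The Laguerre polynomial `L_k^m` of type `m` and degree `k`,
`L_k^m(x) = ∑_{j ≤ k} (-1)^j (k+m choose k-j) x^j / j!`. -/
def laguerre (m k : ℕ) (x : ℝ) : ℝ :=
  ∑ j ∈ Finset.range (k + 1), (-1) ^ j * ((k + m).choose (k - j) : ℝ) * x ^ j / (j ! : ℝ)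

/-- The Laguerre function `φ_{k,λ}^{n-1}(z) = L_k^{n-1}(½|λ||z|²) e^{-¼|λ||z|²}` on `ℂⁿ`. -/
def laguerreFun (n k : ℕ) (l : ℝ) (z : Cn n) : ℝ :=
  laguerre (n - 1) k (|l| * cnorm z ^ 2 / 2) * Real.exp (-(|l| * cnorm z ^ 2 / 4))

/-- The joint eigenfunction `e_{k,λ}^{n-1}(z,t) = e^{iλt} φ_{k,λ}^{n-1}(z)`. -/
def eigenFun (n k : ℕ) (l : ℝ) (p : Hn n) : ℂ :=
  Complex.exp (Complex.I * l * p.2) * (laguerreFun n k l p.1 : ℂ)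

/-- The quotient `J_m(s) / s^m` of the Bessel function of order `m`, with its continuous value
at `s = 0`: `∑_j (-1)^j / (j! (j+m)!) · s^{2j} / 2^{2j+m}`. -/
def besselQuot (m : ℕ) (s : ℝ) : ℝ :=
  ∑' j : ℕ, (-1) ^ j / ((j ! : ℝ) * ((j + m)! : ℝ)) * (s ^ (2 * j) / 2 ^ (2 * j + m))

/-- The Heisenberg fan `Ω ⊆ ℝ²`: the rays `R_k = {(λ, (2k+n)|λ|) : λ ≠ 0}`, `k = 0, 1, 2, …`,
and the limiting ray `R_∞ = {(0, τ) : τ ≥ 0}`. -/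
def fan (n : ℕ) : Set (ℝ × ℝ) :=
  {a | ∃ k : ℕ, a.1 ≠ 0 ∧ a.2 = (2 * k + n) * |a.1|} ∪ {a | a.1 = 0 ∧ 0 ≤ a.2}

/-- The index `k` of the ray `R_k` on which a point of the fan with `λ ≠ 0` lies. -/
def rayIndex {n : ℕ} (a : fan n) : ℕ := sInf {k : ℕ | a.1.2 = (2 * k + n) * |a.1.1|}

/-- The parametrization `λ ↦ (λ, (2k+n)|λ|)` of `R_k`; the value at `λ = 0` is the vertex. -/
def rayPoint (n k : ℕ) (l : ℝ) : fan n :=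
  ⟨(l, (2 * k + n) * |l|), by
    by_cases h : l = 0
    · exact Or.inr ⟨h, by positivity⟩
    · exact Or.inl ⟨k, h, rfl⟩⟩

/-- On `R_k` the index of the ray is `k`. -/
theorem rayIndex_rayPoint (n k : ℕ) {l : ℝ} (hl : l ≠ 0) : rayIndex (rayPoint n k l) = k := by
  have h : {j : ℕ | (rayPoint n k l).1.2 = (2 * j + n) * |(rayPoint n k l).1.1|} = {k} := by
    ext j
    simp only [rayPoint, Set.mem_ofPred_eq, Set.mem_singleton_iff]
    constructor
    · intro h
      have h2 := mul_right_cancel₀ (abs_ne_zero.mpr hl) h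
      have h3 : (k : ℝ) = j := by linarith
      exact_mod_cast h3.symm
    · rintro rfl
      rfl
  rw [rayIndex, h, csInf_singleton]

/-- The Strichartz Fourier transform `f̂(a,w)` of an integrable function on `ℍⁿ`, on all of
`Ω × ℂⁿ`:
`∫ f(z,t) e_a((z,t)⁻¹(w,0)) dz dt` for `a ∈ R_k`, and
`2^{n-1} (n-1)! ∫ f(z,t) J_{n-1}(√τ|w-z|) / (√τ|w-z|)^{n-1} dz dt` for `a = (0,τ) ∈ R_∞`. -/
def strichartz {n : ℕ} (f : Hn n → ℂ) (x : fan n × Cn n) : ℂ :=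
  if x.1.1.1 ≠ 0 then
    ∫ p : Hn n, f p * eigenFun n (rayIndex x.1) x.1.1.1 (mul (inv p) (x.2, 0))
  else
    2 ^ (n - 1) * ((n - 1)! : ℂ) *
      ∫ p : Hn n, f p * (besselQuot (n - 1) (√x.1.1.2 * cnorm (x.2 - p.1)) : ℂ)

/-- The normalized Strichartz Fourier transform `𝓕 f`: it is `c_{n,k} f̂` on `R_k`, with
`c_{n,k} = k! (n-1)! / (k+n-1)!`, and `f̂` on `R_∞`. -/
def normStrichartz {n : ℕ} (f : Hn n → ℂ) (x : fan n × Cn n) : ℂ :=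
  if x.1.1.1 ≠ 0 then
    (((rayIndex x.1)! : ℂ) * ((n - 1)! : ℂ) / ((rayIndex x.1 + n - 1)! : ℂ)) * strichartz f x
  else
    strichartz f x

/-- The measure `ν₂` on the fan:
`∫ φ dν₂ = (2π)^{-2n-1} ∫_ℝ ∑_k ((k+n-1)! / (k! (n-1)!))² φ(λ,(2k+n)|λ|) |λ|^{2n} dλ`. -/
def nuTwo (n : ℕ) : Measure (fan n) :=
  Measure.sum fun k : ℕ =>
    Measure.map (rayPoint n k)
      ((volume : Measure ℝ).withDensity fun l =>
        ENNReal.ofReal (((2 * Real.pi) ^ (2 * n + 1))⁻¹ *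
          (((k + n - 1)! : ℝ) / ((k ! : ℝ) * ((n - 1)! : ℝ))) ^ 2 * |l| ^ (2 * n)))

/-- The measure `dν₂ dw` on `Ω × ℂⁿ`. -/
def freqMeasure (n : ℕ) : Measure (fan n × Cn n) := (nuTwo n).prod volume

/-- `T` is the normalized Strichartz Fourier transform on `L²(ℍⁿ)`: the bounded linear operator
`L²(ℍⁿ) → L²(Ω × ℂⁿ, dν₂ dw)` that is given by the integral formula on `L¹ ∩ L²`. -/
def IsStrichartzL2 {n : ℕ}
    (T : Lp ℂ 2 (volume : Measure (Hn n)) →L[ℂ] Lp ℂ 2 (freqMeasure n)) : Prop :=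
  ∀ f : Lp ℂ 2 (volume : Measure (Hn n)), Integrable (f : Hn n → ℂ) volume →
    (T f : fan n × Cn n → ℂ) =ᵐ[freqMeasure n] normStrichartz (f : Hn n → ℂ)

end Heisenberg

end

noncomputable section

namespace Heisenberg

/-! The theorem is a local uncertainty principle, and it follows from two bounds on the transform:
`L¹ → L^∞` and `L² → L²`, both with constant 1. Write `f = f₁ + f₂`, with `f₁` the part in the
Korányi ball of radius `r`. Since `α < Q/2`, the weight `|(z,t)|^{-α}` is square integrable near the
origin, so `‖f₁‖₁ ≲ r^{Q/2-α} N`, where `N` is the weighted norm; outside the ball the weight gives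
`‖f₂‖₂ ≤ r^{-α} N`. Hence the integral over `E` is at most a constant times `(r^{Q-2α} |E| +
r^{-2α}) N²`, and `r = |E|^{-1/Q}` balances the two terms.

Both transform bounds come from one fact, `integral_twistedIntegrand`: for fixed `λ` the Laguerre
functions `φ_k` are mutually orthogonal under twisted convolution, and each is idempotent up to the
factor `κ = (2π/|λ|)^n`. To prove it, sum against `r^j s^k`: the generating functions are Gaussians,
their twisted convolution is an explicit Gaussian integral, and the result depends only on `rs`.
Comparing coefficients leaves only the diagonal.

Idempotence with Cauchy–Schwarz gives `|φ_k| ≤ φ_k(0)`, and `c_{n,k} φ_k(0) = 1`; this is the `L¹ →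
L^∞` bound `norm_normStrichartz_le`. Orthogonality gives the Bessel inequality
`tsum_lintegral_twConv_le` over `k`; integrated in `λ` and combined with Plancherel in the central
variable, it gives the `L²` bound `lintegral_normStrichartz_le`. Only inequalities are needed, never
completeness of the Laguerre functions. The operator on `L²` is then the extension by density from
`L¹ ∩ L²`. -/

/-! ### Power series and the Laguerre generating function. -/

/-- Two power series in a real variable that agree near `0` have the same coefficients. -/
theorem coeff_eq_of_hasSum_pow {a b : ℕ → ℂ} {f : ℝ → ℂ} {ρ : ℝ} (hρ : 0 < ρ)
    (ha : ∀ r : ℝ, |r| < ρ → HasSum (fun k => (r : ℂ) ^ k * a k) (f r))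
    (hb : ∀ r : ℝ, |r| < ρ → HasSum (fun k => (r : ℂ) ^ k * b k) (f r)) : a = b := by
  have key : ∀ c : ℕ → ℂ, (∀ r : ℝ, |r| < ρ → HasSum (fun k => (r : ℂ) ^ k * c k) (f r)) →
      HasFPowerSeriesAt f
        ((fun n => ContinuousMultilinearMap.mkPiRing ℝ (Fin n) (c n)) :
          FormalMultilinearSeries ℝ ℝ ℂ) 0 := by
    intro c hc
    refine hasFPowerSeriesAt_iff.mpr ?_
    have : ∀ᶠ z : ℝ in nhds 0, |z| < ρ := by
      have := Metric.ball_mem_nhds (0 : ℝ) hρ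
      filter_upwards [this] with z hz
      simpa using hz
    filter_upwards [this] with z hz
    have := hc z hz
    simpa [FormalMultilinearSeries.coeff, ContinuousMultilinearMap.mkPiRing_apply] using this
  have h := (key a ha).eq_formalMultilinearSeries (key b hb)
  funext n
  have := congrFun h n
  simpa using congrArg (fun q => q (fun _ => (1 : ℝ))) this

theorem hasSum_sum_antidiagonal {F : ℕ × ℕ → ℝ} {S : ℝ} (h : HasSum F S) :
    HasSum (fun k => ∑ ij ∈ Finset.HasAntidiagonal.antidiagonal k, F ij) S := by
  have h1 := (Finset.HasAntidiagonal.sigmaAntidiagonalEquivProd (A := ℕ)).hasSum_iff.mpr h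
  refine h1.sigma fun k => ?_
  have := hasSum_fintype (fun c : Finset.HasAntidiagonal.antidiagonal k => F c)
  rw [Finset.sum_coe_sort (Finset.HasAntidiagonal.antidiagonal k) F] at this
  exact this

/-- A crude bound, enough for absolute convergence. With `x = |λ||z|²/2` the Gaussian factor of the
Laguerre function is `e^{-x/2}`, so `e^{x/4}` still leaves integrable decay, and growth `8^k`
permits power series of radius `1/8`. -/
theorem laguerre_bound (m k : ℕ) {x : ℝ} (hx : 0 ≤ x) :
    |laguerre m k x| ≤ 2 ^ m * 8 ^ k * Real.exp (x / 4) := by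
  unfold laguerre
  refine (Finset.abs_sum_le_sum_abs _ _).trans ?_
  have h1 : ∀ j ∈ Finset.range (k + 1),
      |(-1) ^ j * ((k + m).choose (k - j) : ℝ) * x ^ j / (j ! : ℝ)| ≤
        2 ^ m * 8 ^ k * ((x / 4) ^ j / (j ! : ℝ)) := by
    intro j hj
    have hjk : j ≤ k := Nat.lt_succ_iff.mp (Finset.mem_range.mp hj)
    have hc : ((k + m).choose (k - j) : ℝ) ≤ 2 ^ (k + m) := by
      exact_mod_cast Nat.choose_le_two_pow (k + m) (k - j)
    have h4 : (4 : ℝ) ^ j ≤ 4 ^ k := pow_le_pow_right₀ (by norm_num) hjk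
    have e : x ^ j = 4 ^ j * (x / 4) ^ j := by rw [← mul_pow]; congr 1; ring
    rw [abs_div, abs_mul, abs_mul, abs_pow, abs_neg, abs_one, one_pow, one_mul,
      abs_of_nonneg (by positivity : (0 : ℝ) ≤ ((k + m).choose (k - j) : ℝ)),
      abs_of_nonneg (by positivity : (0 : ℝ) ≤ x ^ j),
      abs_of_nonneg (by positivity : (0 : ℝ) ≤ (j ! : ℝ)), e, mul_div_assoc, mul_div_assoc,
      ← mul_assoc]
    refine mul_le_mul_of_nonneg_right ?_ (by positivity)
    calc ((k + m).choose (k - j) : ℝ) * 4 ^ j ≤ 2 ^ (k + m) * 4 ^ k := by gcongr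
      _ = 2 ^ m * 8 ^ k := by
        rw [pow_add, mul_comm (2 ^ k), mul_assoc, ← mul_pow]; norm_num
  refine (Finset.sum_le_sum h1).trans ?_
  rw [← Finset.mul_sum]
  gcongr
  exact Real.sum_le_exp_of_nonneg (by positivity) _

theorem hasSum_choose_geometric (N : ℕ) {r : ℝ} (hr : |r| < 1) :
    HasSum (fun i => ((i + N).choose i : ℝ) * r ^ i) ((1 - r)⁻¹ ^ (N + 1)) := by
  have := hasSum_choose_mul_geometric_of_norm_lt_one N (r := r) (by simpa using hr)
  convert! this using 1
  · funext i
    rw [Nat.choose_symm_add]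
  · simp

theorem hasSum_exp (y : ℝ) : HasSum (fun j : ℕ => y ^ j / (j ! : ℝ)) (Real.exp y) := by
  rw [Real.exp_eq_exp_ℝ]
  exact NormedSpace.expSeries_div_hasSum_exp y

/-- The generating function of the Laguerre polynomials. -/
theorem hasSum_laguerre (m : ℕ) (x : ℝ) {r : ℝ} (hr : |r| < 1) :
    HasSum (fun k => r ^ k * laguerre m k x)
      ((1 - r)⁻¹ ^ (m + 1) * Real.exp (-(x * r * (1 - r)⁻¹))) := by
  -- A double series evaluated in two ways: summing over the second index first gives the closed
  -- form, and summing along `i + j = k` gives `r ^ k * laguerre m k x`.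
  set F : ℝ → ℝ → ℕ × ℕ → ℝ := fun y q ij =>
    y ^ ij.1 / (ij.1 ! : ℝ) * q ^ ij.1 * (((ij.2 + (ij.1 + m)).choose ij.2 : ℝ) * q ^ ij.2)
    with hF
  have inner : ∀ (y q : ℝ), |q| < 1 → ∀ j, HasSum (fun i => F y q (j, i))
      ((1 - q)⁻¹ ^ (m + 1) * ((y * q * (1 - q)⁻¹) ^ j / (j ! : ℝ))) := by
    intro y q hq j
    have := (hasSum_choose_geometric (j + m) hq).mul_left (y ^ j / (j ! : ℝ) * q ^ j)
    convert! this using 1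
    rw [mul_pow, mul_pow, pow_succ, pow_succ, pow_add]
    ring
  have outer : ∀ (y q : ℝ), HasSum (fun j : ℕ =>
      (1 - q)⁻¹ ^ (m + 1) * ((y * q * (1 - q)⁻¹) ^ j / (j ! : ℝ)))
      ((1 - q)⁻¹ ^ (m + 1) * Real.exp (y * q * (1 - q)⁻¹)) := fun y q =>
    (hasSum_exp _).mul_left _
  have hsum : Summable (F (-x) r) := by
    rw [← summable_abs_iff]
    -- All signs sit in the powers of `-x` and `r`, so absolute convergence is convergence of the
    -- same series at `|x|`, `|r|`.
    have e : (fun ij => |F (-x) r ij|) = F |x| |r| := by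
      funext ij
      simp [hF, abs_mul, abs_div, abs_pow, Nat.abs_cast]
    rw [e, summable_prod_of_nonneg (fun ij => by positivity)]
    have hr' : |(|r|)| < 1 := by rwa [abs_abs]
    refine ⟨fun j => (inner |x| |r| hr' j).summable, ?_⟩
    simp_rw [(inner |x| |r| hr' _).tsum_eq]
    exact (outer |x| |r|).summable
  have h1 : HasSum (F (-x) r) ((1 - r)⁻¹ ^ (m + 1) * Real.exp (-x * r * (1 - r)⁻¹)) := by
    have h2 := hsum.hasSum.prod_fiberwise (inner (-x) r hr)
    rw [← h2.unique (outer (-x) r)]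
    exact hsum.hasSum
  have h3 := hasSum_sum_antidiagonal h1
  convert! h3 using 1
  · funext k
    rw [Finset.Nat.sum_antidiagonal_eq_sum_range_succ_mk, laguerre, Finset.mul_sum]
    refine Finset.sum_congr rfl fun j hj => ?_
    have hjk : j ≤ k := Nat.lt_succ_iff.mp (Finset.mem_range.mp hj)
    obtain ⟨i, rfl⟩ := Nat.exists_eq_add_of_le hjk
    simp only [hF, add_tsub_cancel_left]
    rw [show i + (j + m) = j + i + m by ring, neg_pow, pow_add]
    ring
  · congr 2
    ring

/-! ### The symplectic form and Gaussian integrals. -/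

/-- The imaginary part of the Hermitian product `z · w̄`. -/
def sympl {n : ℕ} (z w : Cn n) : ℝ := (∑ j, z j * (starRingEnd ℂ) (w j)).im

theorem sympl_eq_sum {n : ℕ} (z w : Cn n) :
    sympl z w = ∑ j, (z j * (starRingEnd ℂ) (w j)).im := Complex.im_sum _ _

theorem cnorm_sq {n : ℕ} (z : Cn n) : cnorm z ^ 2 = ∑ j, ‖z j‖ ^ 2 :=
  Real.sq_sqrt (by positivity)

theorem cnorm_zero {n : ℕ} : cnorm (0 : Cn n) = 0 := by simp [cnorm]

theorem cnorm_neg {n : ℕ} (z : Cn n) : cnorm (-z) = cnorm z := by simp [cnorm]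

@[fun_prop]
theorem continuous_cnorm {n : ℕ} : Continuous (cnorm : Cn n → ℝ) := by
  unfold cnorm; fun_prop

@[fun_prop]
theorem continuous_sympl {n : ℕ} : Continuous (fun p : Cn n × Cn n => sympl p.1 p.2) := by
  unfold sympl
  refine Complex.continuous_im.comp (continuous_finsetSum _ fun j _ => ?_)
  exact ((continuous_apply j).comp continuous_fst).mul
    (Complex.continuous_conj.comp ((continuous_apply j).comp continuous_snd))

@[fun_prop]
theorem continuous_laguerre (m k : ℕ) : Continuous (laguerre m k) := by
  unfold laguerre; fun_prop

theorem continuous_laguerreFun (n k : ℕ) :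
    Continuous (fun p : ℝ × Cn n => laguerreFun n k p.1 p.2) := by
  unfold laguerreFun; fun_prop

theorem continuous_laguerreFun_right (n k : ℕ) (l : ℝ) :
    Continuous (laguerreFun n k l : Cn n → ℝ) := by
  unfold laguerreFun; fun_prop

theorem continuous_sympl_right {n : ℕ} (v : Cn n) : Continuous (sympl v) := by
  unfold sympl
  refine Complex.continuous_im.comp (continuous_finsetSum _ fun j _ => ?_)
  exact continuous_const.mul (Complex.continuous_conj.comp (continuous_apply j))

/-- In real coordinates the integrand splits into two one-dimensional Gaussians with complex linear
terms `B₁`, `B₂`, and each is integrated by completing the square. -/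
theorem gaussian_integral_complex {l a b : ℝ} (hl : l ≠ 0) (ha : 0 < a) (hb : 0 < b) (v : ℂ) :
    ∫ u : ℂ, Complex.exp (Complex.I * l * ((v * (starRingEnd ℂ) u).im : ℝ) / 2
        - |l| * a / 4 * ‖u - v‖ ^ 2 - |l| * b / 4 * ‖u‖ ^ 2) =
      (4 * Real.pi / (|l| * (a + b)) : ℝ) *
        Complex.exp (-(|l| / 4 * ‖v‖ ^ 2 * ((a * b + 1) / (a + b)) : ℝ)) := by
  have hL : 0 < |l| := abs_pos.mpr hl
  set A : ℝ := |l| * (a + b) / 4 with hA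
  have hA0 : 0 < A := by positivity
  set B₁ : ℂ := |l| * a / 2 * v.re + Complex.I * l / 2 * v.im with hB₁
  set B₂ : ℂ := |l| * a / 2 * v.im - Complex.I * l / 2 * v.re with hB₂
  set d : ℂ := -(|l| * a / 4 * ‖v‖ ^ 2) with hd
  rw [← Complex.volume_preserving_equiv_real_prod.symm.integral_comp']
  have e : ∀ p : ℝ × ℝ,
      Complex.exp (Complex.I * l *
        ((v * (starRingEnd ℂ) (Complex.measurableEquivRealProd.symm p)).im : ℝ) / 2
        - |l| * a / 4 * ‖Complex.measurableEquivRealProd.symm p - v‖ ^ 2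
        - |l| * b / 4 * ‖Complex.measurableEquivRealProd.symm p‖ ^ 2) =
      Complex.exp (-(A : ℂ) * p.1 ^ 2 + B₁ * p.1 + d) *
        Complex.exp (-(A : ℂ) * p.2 ^ 2 + B₂ * p.2 + 0) := by
    intro p
    rw [← Complex.exp_add]
    congr 1
    have h : ∀ z : ℂ, ((‖z‖ : ℝ) : ℂ) ^ 2 = (z.re : ℂ) ^ 2 + (z.im : ℂ) ^ 2 := by
      intro z
      rw [← Complex.ofReal_pow, Complex.sq_norm, Complex.normSq_apply]
      push_cast; ring
    simp only [hd, h, hA, hB₁, hB₂, Complex.measurableEquivRealProd_symm_apply]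
    simp only [Complex.mul_im, Complex.conj_re, Complex.conj_im, Complex.sub_re, Complex.sub_im]
    push_cast
    ring
  simp_rw [e]
  rw [show (volume : Measure (ℝ × ℝ)) = (volume : Measure ℝ).prod volume from rfl,
    integral_prod_mul (fun x : ℝ => Complex.exp (-(A : ℂ) * x ^ 2 + B₁ * x + d))
      (fun x : ℝ => Complex.exp (-(A : ℂ) * x ^ 2 + B₂ * x + 0)),
    integral_cexp_quadratic (by simpa using hA0), integral_cexp_quadratic (by simpa using hA0)]
  have hAc : (A : ℂ) ≠ 0 := by exact_mod_cast hA0.ne'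
  have hpi : (Real.pi / - -(A : ℂ)) ≠ 0 := by
    rw [neg_neg]
    exact div_ne_zero (by exact_mod_cast Real.pi_ne_zero) hAc
  rw [mul_mul_mul_comm, ← Complex.cpow_add _ _ hpi, ← Complex.exp_add]
  congr 1
  · norm_num [hA]
    have : ((|l| : ℝ) : ℂ) ≠ 0 := by exact_mod_cast hL.ne'
    field_simp
  · congr 1
    have h : ((‖v‖ : ℝ) : ℂ) ^ 2 = (v.re : ℂ) ^ 2 + (v.im : ℂ) ^ 2 := by
      rw [← Complex.ofReal_pow, Complex.sq_norm, Complex.normSq_apply]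
      push_cast; ring
    have hl2 : (l : ℂ) ^ 2 = ((|l| : ℝ) : ℂ) ^ 2 := by exact_mod_cast (sq_abs l).symm
    -- The mixed terms in `v.re * v.im` cancel between the two squares, and the oscillating phase
    -- contributes the `-1` through `I ^ 2`.
    have hsq : B₁ ^ 2 + B₂ ^ 2 = ((|l| : ℝ) : ℂ) ^ 2 / 4 * (a ^ 2 - 1) * ((v.re : ℂ) ^ 2 + (v.im : ℂ) ^ 2) := by
      have : B₁ ^ 2 + B₂ ^ 2 = (((|l| : ℝ) : ℂ) ^ 2 * a ^ 2 / 4 + Complex.I ^ 2 * (l : ℂ) ^ 2 / 4) *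
          ((v.re : ℂ) ^ 2 + (v.im : ℂ) ^ 2) := by
        simp only [hB₁, hB₂]; ring
      rw [this, Complex.I_sq, hl2]; ring
    have : d - B₁ ^ 2 / (4 * -(A : ℂ)) + (0 - B₂ ^ 2 / (4 * -(A : ℂ))) =
        d + (B₁ ^ 2 + B₂ ^ 2) / (4 * A) := by
      field_simp; ring
    rw [this, hsq]
    have hLc : ((|l| : ℝ) : ℂ) ≠ 0 := by exact_mod_cast hL.ne'
    have hab : (a + b : ℂ) ≠ 0 := by exact_mod_cast (add_pos ha hb).ne'
    push_cast
    rw [hd, hA, h]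
    push_cast
    field_simp
    ring

/-- The Gaussian integral behind the twisted convolution of two radial Gaussians. -/
theorem gaussian_integral {n : ℕ} {l a b : ℝ} (hl : l ≠ 0) (ha : 0 < a) (hb : 0 < b) (v : Cn n) :
    ∫ u : Cn n, Complex.exp (Complex.I * l * sympl v u / 2
        - |l| * a / 4 * cnorm (u - v) ^ 2 - |l| * b / 4 * cnorm u ^ 2) =
      ((4 * Real.pi / (|l| * (a + b))) ^ n *
        Real.exp (-(|l| / 4 * cnorm v ^ 2 * ((a * b + 1) / (a + b)))) : ℝ) := by
  have e : ∀ u : Cn n, Complex.exp (Complex.I * l * sympl v u / 2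
        - |l| * a / 4 * cnorm (u - v) ^ 2 - |l| * b / 4 * cnorm u ^ 2) =
      ∏ j, Complex.exp (Complex.I * l * ((v j * (starRingEnd ℂ) (u j)).im : ℝ) / 2
        - |l| * a / 4 * ‖u j - v j‖ ^ 2 - |l| * b / 4 * ‖u j‖ ^ 2) := by
    intro u
    rw [← Complex.exp_sum]
    congr 1
    rw [← Complex.ofReal_pow, ← Complex.ofReal_pow, cnorm_sq, cnorm_sq, sympl_eq_sum]
    push_cast
    rw [Finset.mul_sum, Finset.sum_div, Finset.mul_sum, Finset.mul_sum, ← Finset.sum_sub_distrib,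
      ← Finset.sum_sub_distrib]
    rfl
  simp_rw [e]
  rw [integral_fintype_prod_volume_eq_prod (fun j (u : ℂ) =>
    Complex.exp (Complex.I * l * ((v j * (starRingEnd ℂ) u).im : ℝ) / 2
        - |l| * a / 4 * ‖u - v j‖ ^ 2 - |l| * b / 4 * ‖u‖ ^ 2))]
  simp_rw [gaussian_integral_complex hl ha hb]
  rw [Finset.prod_mul_distrib, ← Complex.exp_sum]
  simp only [Finset.prod_const, Finset.card_univ, Fintype.card_fin]
  rw [Complex.ofReal_mul, Complex.ofReal_pow, Complex.ofReal_exp]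
  congr 2
  rw [cnorm_sq]
  push_cast
  rw [Finset.sum_neg_distrib, Finset.mul_sum, Finset.sum_mul]

theorem integrable_gaussian (n : ℕ) {c : ℝ} (hc : 0 < c) :
    Integrable (fun u : Cn n => Real.exp (-(c * cnorm u ^ 2))) := by
  have h1 : Integrable (fun u : ℂ => Real.exp (-(c * ‖u‖ ^ 2))) := by
    have := (GaussianFourier.integrable_cexp_neg_mul_sq_norm_add (V := ℂ) (b := c)
      (by simpa using hc) 0 0).norm
    refine this.congr (Filter.Eventually.of_forall fun u => ?_)
    simp only [Complex.norm_exp]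
    congr 1
    simp [← Complex.ofReal_pow]
  have h2 : Integrable (fun u : Cn n => ∏ j, Real.exp (-(c * ‖u j‖ ^ 2))) :=
    Integrable.fintype_prod (f := fun _ (u : ℂ) => Real.exp (-(c * ‖u‖ ^ 2))) fun _ => h1
  refine h2.congr (Filter.Eventually.of_forall fun u => ?_)
  simp only [← Real.exp_sum]
  rw [cnorm_sq, Finset.sum_neg_distrib, Finset.mul_sum]

theorem laguerreFun_bound (n k : ℕ) (l : ℝ) (z : Cn n) :
    |laguerreFun n k l z| ≤ 2 ^ (n - 1) * 8 ^ k * Real.exp (-(|l| / 8 * cnorm z ^ 2)) := by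
  unfold laguerreFun
  rw [abs_mul, Real.abs_exp]
  have := laguerre_bound (n - 1) k (x := |l| * cnorm z ^ 2 / 2) (by positivity)
  refine (mul_le_mul_of_nonneg_right this (Real.exp_pos _).le).trans ?_
  rw [mul_assoc, ← Real.exp_add]
  refine le_of_eq ?_
  congr 2
  ring

theorem laguerreFun_bound' (n k : ℕ) (l : ℝ) (z : Cn n) :
    |laguerreFun n k l z| ≤ 2 ^ (n - 1) * 8 ^ k := by
  refine (laguerreFun_bound n k l z).trans ?_
  refine mul_le_of_le_one_right (by positivity) ?_
  rw [Real.exp_le_one_iff]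
  simp only [Left.neg_nonpos_iff]
  positivity

/-- The generating function of the Laguerre functions is a pure Gaussian, of width parameter `(1 +
r) / (1 - r)`; this turns twisted convolutions of them into Gaussian integrals. -/
theorem hasSum_laguerreFun {n : ℕ} (hn : 1 ≤ n) (l : ℝ) (z : Cn n) {r : ℝ} (hr : |r| < 1) :
    HasSum (fun k => r ^ k * laguerreFun n k l z)
      ((1 - r)⁻¹ ^ n * Real.exp (-(|l| * ((1 + r) / (1 - r)) / 4 * cnorm z ^ 2))) := by
  have h := (hasSum_laguerre (n - 1) (|l| * cnorm z ^ 2 / 2) hr).mul_right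
    (Real.exp (-(|l| * cnorm z ^ 2 / 4)))
  have hr1 : 1 - r ≠ 0 := by have := (abs_lt.mp hr).2; linarith
  convert! h using 1
  · funext k
    rw [laguerreFun, mul_assoc]
  · rw [Nat.sub_add_cancel hn, mul_assoc, ← Real.exp_add]
    congr 2
    field_simp
    ring

/-! ### Twisted convolution of Laguerre functions. -/

/-- The integrand of the twisted convolution of two Laguerre functions. -/
def twistedIntegrand (n : ℕ) (l : ℝ) (v : Cn n) (jk : ℕ × ℕ) (u : Cn n) : ℂ :=
  Complex.exp (Complex.I * l * sympl v u / 2) *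
    ((laguerreFun n jk.1 l (u - v) * laguerreFun n jk.2 l u : ℝ) : ℂ)

theorem norm_exp_I_mul (l s : ℝ) : ‖Complex.exp (Complex.I * l * s / 2)‖ = 1 := by
  rw [show Complex.I * l * s / 2 = ((l * s / 2 : ℝ) : ℂ) * Complex.I by push_cast; ring,
    Complex.norm_exp_ofReal_mul_I]

theorem norm_twistedIntegrand_le (n : ℕ) (l : ℝ) (v : Cn n) (jk : ℕ × ℕ) (u : Cn n) :
    ‖twistedIntegrand n l v jk u‖ ≤
      (8 ^ jk.1 * 8 ^ jk.2) * (2 ^ (n - 1) * 2 ^ (n - 1) * Real.exp (-(|l| / 8 * cnorm u ^ 2))) := by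
  rw [twistedIntegrand, norm_mul, norm_exp_I_mul, one_mul, Complex.norm_real, Real.norm_eq_abs,
    abs_mul]
  refine (mul_le_mul (laguerreFun_bound' n jk.1 l (u - v)) (laguerreFun_bound n jk.2 l u)
    (abs_nonneg _) (by positivity)).trans (le_of_eq ?_)
  ring

theorem continuous_twistedIntegrand (n : ℕ) (l : ℝ) (v : Cn n) (jk : ℕ × ℕ) :
    Continuous (twistedIntegrand n l v jk) := by
  unfold twistedIntegrand
  have h1 := continuous_sympl_right v
  have h2 := (continuous_laguerreFun_right n jk.1 l).comp (continuous_sub_right v)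
  have h3 := continuous_laguerreFun_right n jk.2 l
  refine Continuous.mul (Complex.continuous_exp.comp ?_) (Complex.continuous_ofReal.comp (h2.mul h3))
  exact (continuous_const.mul (Complex.continuous_ofReal.comp h1)).div_const 2

theorem integrable_twistedIntegrand (n : ℕ) {l : ℝ} (hl : l ≠ 0) (v : Cn n) (jk : ℕ × ℕ) :
    Integrable (twistedIntegrand n l v jk) := by
  have hL : 0 < |l| := abs_pos.mpr hl
  have h : Integrable fun u : Cn n => ((8 : ℝ) ^ jk.1 * 8 ^ jk.2) *
      (2 ^ (n - 1) * 2 ^ (n - 1) * Real.exp (-(|l| / 8 * cnorm u ^ 2))) :=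
    ((integrable_gaussian n (c := |l| / 8) (by positivity)).const_mul _).const_mul _
  exact Integrable.mono' h
    (continuous_twistedIntegrand n l v jk).aestronglyMeasurable
    (Filter.Eventually.of_forall (norm_twistedIntegrand_le n l v jk))

theorem hasSum_twistedIntegrand {n : ℕ} (hn : 1 ≤ n) (l : ℝ) (v u : Cn n)
    {r s : ℝ} (hr : |r| < 1) (hs : |s| < 1) :
    HasSum (fun jk : ℕ × ℕ => (r : ℂ) ^ jk.1 * (s : ℂ) ^ jk.2 * twistedIntegrand n l v jk u)
      ((((1 - r)⁻¹ ^ n * (1 - s)⁻¹ ^ n : ℝ) : ℂ) *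
      Complex.exp (Complex.I * l * sympl v u / 2
        - |l| * ((1 + r) / (1 - r) : ℝ) / 4 * cnorm (u - v) ^ 2
        - |l| * ((1 + s) / (1 - s) : ℝ) / 4 * cnorm u ^ 2)) := by
  have e1 := hasSum_laguerreFun hn l (u - v) hr
  have e2 := hasSum_laguerreFun hn l u hs
  have e3 := e1.mul e2 (summable_mul_of_summable_norm
    (f := fun k => r ^ k * laguerreFun n k l (u - v)) (g := fun k => s ^ k * laguerreFun n k l u)
    e1.summable.abs e2.summable.abs)
  have e4 := (Complex.hasSum_ofReal.mpr e3).mul_left (Complex.exp (Complex.I * l * sympl v u / 2))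
  convert! e4 using 1
  · funext jk
    simp only [twistedIntegrand]
    push_cast
    ring
  · rw [Complex.exp_sub, Complex.exp_sub, div_eq_mul_inv, div_eq_mul_inv, ← Complex.exp_neg,
      ← Complex.exp_neg]
    push_cast
    ring

/-- With `a = (1+r)/(1-r)` and `b = (1+s)/(1-s)` one has `(ab+1)/(a+b) = (1+rs)/(1-rs)`, and the
prefactors combine in the same way, so the sum depends on `r` and `s` only through `rs`. The radius
`1/8` makes the `8^j 8^k` bounds summable, which justifies integrating term by term. -/
theorem hasSum_integral_twistedIntegrand {n : ℕ} (hn : 1 ≤ n) {l : ℝ} (hl : l ≠ 0) (v : Cn n)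
    {r s : ℝ} (hr : |r| < 1 / 8) (hs : |s| < 1 / 8) :
    HasSum (fun jk : ℕ × ℕ => (r : ℂ) ^ jk.1 * (s : ℂ) ^ jk.2 * ∫ u, twistedIntegrand n l v jk u)
      (((2 * Real.pi / |l|) ^ n * ((1 - r * s)⁻¹ ^ n *
        Real.exp (-(|l| * ((1 + r * s) / (1 - r * s)) / 4 * cnorm v ^ 2))) : ℝ) : ℂ) := by
  have hL : 0 < |l| := abs_pos.mpr hl
  set F : ℕ × ℕ → Cn n → ℂ := fun jk u =>
    (r : ℂ) ^ jk.1 * (s : ℂ) ^ jk.2 * twistedIntegrand n l v jk u with hF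
  have hintegr : ∀ jk, Integrable (F jk) := fun jk =>
    (integrable_twistedIntegrand n hl v jk).const_mul _
  set G : ℝ := ∫ u : Cn n, 2 ^ (n - 1) * 2 ^ (n - 1) * Real.exp (-(|l| / 8 * cnorm u ^ 2)) with hG
  have hgi : Integrable fun u : Cn n =>
      2 ^ (n - 1) * 2 ^ (n - 1) * Real.exp (-(|l| / 8 * cnorm u ^ 2)) :=
    (integrable_gaussian n (c := |l| / 8) (by positivity)).const_mul _
  have hbound : ∀ jk, ∫ u, ‖F jk u‖ ≤ ((8 * |r|) ^ jk.1 * (8 * |s|) ^ jk.2) * G := by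
    intro jk
    rw [hG, ← integral_const_mul]
    refine integral_mono (hintegr jk).norm (hgi.const_mul _) fun u => ?_
    simp only [hF, norm_mul, norm_pow, Complex.norm_real, Real.norm_eq_abs]
    refine (mul_le_mul_of_nonneg_left (norm_twistedIntegrand_le n l v jk u)
      (by positivity)).trans (le_of_eq ?_)
    rw [mul_pow, mul_pow]; ring
  have hsumm : Summable fun jk => ∫ u, ‖F jk u‖ := by
    refine Summable.of_nonneg_of_le (fun jk => integral_nonneg fun u => norm_nonneg _) hbound ?_
    refine Summable.mul_right _ ?_
    refine Summable.mul_of_nonneg (f := fun j : ℕ => (8 * |r|) ^ j)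
      (g := fun j : ℕ => (8 * |s|) ^ j) ?_ ?_ (fun j => by positivity) (fun j => by positivity)
    · exact summable_geometric_of_lt_one (by positivity) (by linarith)
    · exact summable_geometric_of_lt_one (by positivity) (by linarith)
  have h1 := hasSum_integral_of_summable_integral_norm hintegr hsumm
  have hr1 : |r| < 1 := by linarith
  have hs1 : |s| < 1 := by linarith
  obtain ⟨hr2, hr3⟩ := abs_lt.mp hr
  obtain ⟨hs2, hs3⟩ := abs_lt.mp hs
  have ha : 0 < (1 + r) / (1 - r) := div_pos (by linarith) (by linarith)
  have hb : 0 < (1 + s) / (1 - s) := div_pos (by linarith) (by linarith)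
  have hrs : 0 < 1 - r * s := by nlinarith [abs_mul r s, le_abs_self (r * s), abs_nonneg r, abs_nonneg s]
  have hpt : ∀ u, ∑' jk, F jk u = _ := fun u => (hasSum_twistedIntegrand hn l v u hr1 hs1).tsum_eq
  have e : (fun jk : ℕ × ℕ => (r : ℂ) ^ jk.1 * (s : ℂ) ^ jk.2 * ∫ u, twistedIntegrand n l v jk u) =
      fun jk => ∫ u, F jk u := by
    funext jk
    simp only [hF]
    rw [integral_const_mul]
  rw [e]
  convert! h1 using 1
  simp_rw [hpt]
  rw [integral_const_mul, gaussian_integral hl ha hb, ← Complex.ofReal_mul]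
  congr 1
  have h1r : 1 - r ≠ 0 := by linarith
  have h1s : 1 - s ≠ 0 := by linarith
  have hab : (1 + r) / (1 - r) + (1 + s) / (1 - s) = 2 * (1 - r * s) / ((1 - r) * (1 - s)) := by
    field_simp; ring
  have hab1 : (1 + r) / (1 - r) * ((1 + s) / (1 - s)) + 1 =
      2 * (1 + r * s) / ((1 - r) * (1 - s)) := by
    field_simp; ring
  rw [hab1, hab, ← mul_assoc, ← mul_assoc, ← mul_pow, ← mul_pow, ← mul_pow]
  congr 2
  · field_simp; ring
  · field_simp

/-- Distinct Laguerre functions are orthogonal for twisted convolution, and each of them is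
idempotent up to a scalar. -/
theorem integral_twistedIntegrand {n : ℕ} (hn : 1 ≤ n) {l : ℝ} (hl : l ≠ 0) (v : Cn n) (j k : ℕ) :
    ∫ u, twistedIntegrand n l v (j, k) u =
      if j = k then (((2 * Real.pi / |l|) ^ n * laguerreFun n k l v : ℝ) : ℂ) else 0 := by
  set M : ℕ → ℕ → ℂ := fun j k => ∫ u, twistedIntegrand n l v (j, k) u with hM
  set κ : ℝ := (2 * Real.pi / |l|) ^ n with hκ
  have hfib : ∀ s : ℝ, |s| < 1 / 8 → ∀ j,
      HasSum (fun k => (s : ℂ) ^ k * M j k) ((s : ℂ) ^ j * (κ * laguerreFun n j l v : ℝ)) := by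
    intro s hs
    have hfs : ∀ j, Summable fun k => (s : ℂ) ^ k * M j k := by
      intro j
      -- Any nonzero `r` with `|r| < 1/8` would do: a row of the absolutely convergent double series
      -- is summable, and the factor `r ^ j` can be divided out.
      have h := (hasSum_integral_twistedIntegrand hn hl v (r := 1 / 16) (by norm_num [abs_of_pos])
        hs).summable.prod_factor j
      have h2 := h.mul_left (((1 / 16 : ℝ) : ℂ) ^ j)⁻¹
      refine h2.congr fun k => ?_
      have : (((1 / 16 : ℝ) : ℂ) ^ j) ≠ 0 := pow_ne_zero _ (by norm_num)
      simp only [hM]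
      field_simp
    -- For fixed `s` both sides are coefficients of one power series in `r`: the right-hand one is
    -- the Laguerre generating function at `r * s`.
    have key : (fun j => ∑' k, (s : ℂ) ^ k * M j k) =
        fun j => (s : ℂ) ^ j * (κ * laguerreFun n j l v : ℝ) := by
      refine coeff_eq_of_hasSum_pow (f := fun r => ((κ * ((1 - r * s)⁻¹ ^ n *
        Real.exp (-(|l| * ((1 + r * s) / (1 - r * s)) / 4 * cnorm v ^ 2))) : ℝ) : ℂ))
        (ρ := 1 / 8) (by norm_num) ?_ ?_
      · intro r hr
        refine (hasSum_integral_twistedIntegrand hn hl v hr hs).prod_fiberwise fun j => ?_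
        have := (hfs j).hasSum.mul_left ((r : ℂ) ^ j)
        simpa only [mul_assoc] using this
      · intro r hr
        have hrs : |r * s| < 1 := by
          rw [abs_mul]; nlinarith [abs_nonneg r, abs_nonneg s]
        have := (hasSum_laguerreFun hn l v hrs).mul_left κ
        have := Complex.hasSum_ofReal.mpr this
        convert! this using 1
        funext j
        push_cast
        rw [mul_pow]; ring
    intro j
    have := (hfs j).hasSum
    rwa [congrFun key j] at this
  -- Now compare coefficients in `s`: row `j` of the matrix `M` sums to the single monomial of
  -- degree `j`.
  have : (fun k => M j k) = fun k => if j = k then ((κ * laguerreFun n k l v : ℝ) : ℂ) else 0 := by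
    refine coeff_eq_of_hasSum_pow (ρ := 1 / 8) (by norm_num)
      (f := fun s => (s : ℂ) ^ j * (κ * laguerreFun n j l v : ℝ)) (fun s hs => hfib s hs j) ?_
    intro s _
    convert! hasSum_single (f := fun k => (s : ℂ) ^ k *
      (if j = k then ((κ * laguerreFun n k l v : ℝ) : ℂ) else 0)) j ?_ using 1
    · simp
    · intro k hk
      simp [hk.symm]
  exact congrFun this k

/-! ### Twisted convolution operators, the maximum of the Laguerre functions and the Bessel
inequality. -/

theorem sympl_neg_swap {n : ℕ} (z w : Cn n) : sympl z w = -sympl w z := by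
  rw [sympl_eq_sum, sympl_eq_sum, ← Finset.sum_neg_distrib]
  refine Finset.sum_congr rfl fun j _ => ?_
  simp only [Complex.mul_im, Complex.conj_re, Complex.conj_im]
  ring

/-- The cocycle identity that makes the phases of two kernels combine, after translation by `z`,
into a constant phase and the phase of `twistedIntegrand` at `z' - z`. -/
theorem sympl_sub_add {n : ℕ} (z z' u : Cn n) :
    sympl z' (u + z) - sympl z (u + z) = sympl z' z + sympl (z' - z) u := by
  simp only [sympl_eq_sum, ← Finset.sum_sub_distrib, ← Finset.sum_add_distrib]
  refine Finset.sum_congr rfl fun j _ => ?_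
  simp only [Pi.add_apply, Pi.sub_apply, Complex.mul_im, Complex.conj_re, Complex.conj_im,
    Complex.add_re, Complex.add_im, Complex.sub_re, Complex.sub_im, map_add]
  ring

/-- The kernel of twisted convolution with the Laguerre function `φ_{k,λ}`. -/
def twKer (n k : ℕ) (l : ℝ) (w z : Cn n) : ℂ :=
  Complex.exp (-(Complex.I * l * sympl z w / 2)) * (laguerreFun n k l (w - z) : ℂ)

theorem norm_twKer (n k : ℕ) (l : ℝ) (w z : Cn n) :
    ‖twKer n k l w z‖ = |laguerreFun n k l (w - z)| := by
  have := norm_exp_I_mul (-l) (sympl z w)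
  rw [twKer, norm_mul, Complex.norm_real, Real.norm_eq_abs,
    show -(Complex.I * l * sympl z w / 2) = Complex.I * ((-l : ℝ) : ℂ) * sympl z w / 2 by
      push_cast; ring, this, one_mul]

theorem laguerreFun_neg (n k : ℕ) (l : ℝ) (z : Cn n) :
    laguerreFun n k l (-z) = laguerreFun n k l z := by
  simp [laguerreFun, cnorm_neg]

theorem conj_twKer (n k : ℕ) (l : ℝ) (w z : Cn n) :
    (starRingEnd ℂ) (twKer n k l w z) = twKer n k l z w := by
  rw [twKer, twKer, map_mul, ← Complex.exp_conj, Complex.conj_ofReal, sympl_neg_swap w z,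
    ← neg_sub w z, laguerreFun_neg]
  congr 2
  simp [Complex.conj_ofNat]

theorem continuous_twKer (n k : ℕ) (l : ℝ) :
    Continuous fun p : Cn n × Cn n => twKer n k l p.1 p.2 := by
  have h1 : Continuous fun p : Cn n × Cn n => sympl p.2 p.1 := continuous_sympl.comp continuous_swap
  have h2 : Continuous fun p : Cn n × Cn n => laguerreFun n k l (p.1 - p.2) :=
    (continuous_laguerreFun_right n k l).comp continuous_sub
  unfold twKer
  refine Continuous.mul (Complex.continuous_exp.comp ?_) (Complex.continuous_ofReal.comp h2)
  exact ((continuous_const.mul (Complex.continuous_ofReal.comp h1)).div_const 2).neg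

theorem integrable_laguerreFun (n k : ℕ) {l : ℝ} (hl : l ≠ 0) :
    Integrable (laguerreFun n k l : Cn n → ℝ) := by
  have hL : 0 < |l| := abs_pos.mpr hl
  have h : Integrable fun u : Cn n => (2 ^ (n - 1) * 8 ^ k : ℝ) *
      Real.exp (-(|l| / 8 * cnorm u ^ 2)) :=
    (integrable_gaussian n (c := |l| / 8) (by positivity)).const_mul _
  exact Integrable.mono' h (continuous_laguerreFun_right n k l).aestronglyMeasurable
    (Filter.Eventually.of_forall (laguerreFun_bound n k l))

theorem integrable_twKer_left (n k : ℕ) {l : ℝ} (hl : l ≠ 0) (z : Cn n) :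
    Integrable fun w => twKer n k l w z := by
  refine Integrable.mono' ((integrable_laguerreFun n k hl).comp_sub_right z).norm
    ((continuous_twKer n k l).comp (Continuous.prodMk_left z)).aestronglyMeasurable
    (Filter.Eventually.of_forall fun w => ?_)
  rw [norm_twKer, Real.norm_eq_abs]

/-- The reproducing property of the twisted convolution kernels, and the orthogonality of
different ones. -/
theorem integral_conj_twKer_mul {n : ℕ} (hn : 1 ≤ n) {l : ℝ} (hl : l ≠ 0) (j k : ℕ)
    (z z' : Cn n) :
    ∫ w, (starRingEnd ℂ) (twKer n j l w z') * twKer n k l w z =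
      if j = k then (((2 * Real.pi / |l|) ^ n : ℝ) : ℂ) * twKer n k l z' z else 0 := by
  rw [← integral_add_right_eq_self _ z]
  have e : ∀ u : Cn n, (starRingEnd ℂ) (twKer n j l (u + z) z') * twKer n k l (u + z) z =
      Complex.exp (Complex.I * l * sympl z' z / 2) * twistedIntegrand n l (z' - z) (j, k) u := by
    intro u
    have h := sympl_sub_add z z' u
    rw [conj_twKer, twKer, twKer, twistedIntegrand, sympl_neg_swap (u + z) z', ← laguerreFun_neg,
      mul_mul_mul_comm, ← Complex.exp_add, ← mul_assoc (Complex.exp _) (Complex.exp _),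
      ← Complex.exp_add]
    congr 2
    · have h' : (sympl z' (u + z) : ℂ) = sympl z' z + sympl (z' - z) u + sympl z (u + z) := by
        have : sympl z' (u + z) = sympl z' z + sympl (z' - z) u + sympl z (u + z) := by linarith
        rw [this]; push_cast; ring
      push_cast
      rw [h']
      ring
    · rw [← Complex.ofReal_mul]
      congr 3
      · abel
      · abel
  simp_rw [e]
  rw [integral_const_mul, integral_twistedIntegrand hn hl]
  split_ifs with h
  · rw [twKer, sympl_neg_swap z z']
    push_cast
    rw [show -(Complex.I * l * -(sympl z' z : ℂ) / 2) = Complex.I * l * (sympl z' z : ℂ) / 2 by ring]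
    ring
  · simp

theorem laguerre_zero (m k : ℕ) : laguerre m k 0 = (k + m).choose k := by
  rw [laguerre, Finset.sum_range_succ']
  simp

theorem laguerreFun_zero (n k : ℕ) (l : ℝ) :
    laguerreFun n k l (0 : Cn n) = (k + (n - 1)).choose k := by
  simp [laguerreFun, cnorm_zero, laguerre_zero]

/-- The Laguerre functions attain their maximum at the origin. -/
theorem abs_laguerreFun_le {n : ℕ} (hn : 1 ≤ n) (k : ℕ) {l : ℝ} (hl : l ≠ 0) (v : Cn n) :
    |laguerreFun n k l v| ≤ (k + (n - 1)).choose k := by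
  have hκ : 0 < (2 * Real.pi / |l|) ^ n := by
    have := abs_pos.mpr hl
    positivity
  have h0 := integral_twistedIntegrand hn hl (0 : Cn n) k k
  have hv := integral_twistedIntegrand hn hl v k k
  simp only [if_true] at h0 hv
  set p : Cn n → ℝ := laguerreFun n k l with hp
  have hc : Continuous p := continuous_laguerreFun_right n k l
  have e0 : ∀ u, twistedIntegrand n l (0 : Cn n) (k, k) u = ((p u ^ 2 : ℝ) : ℂ) := by
    intro u
    simp [twistedIntegrand, sympl_eq_sum, hp, sq]
  have hsq : Integrable fun u => p u ^ 2 := by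
    have := (integrable_twistedIntegrand n hl (0 : Cn n) (k, k)).re
    refine this.congr (Filter.Eventually.of_forall fun u => ?_)
    simp [e0, -Complex.ofReal_pow]
  simp_rw [e0] at h0
  rw [integral_complex_ofReal] at h0
  have h0' : ∫ u, p u ^ 2 = (2 * Real.pi / |l|) ^ n * (k + (n - 1)).choose k := by
    have := Complex.ofReal_injective h0
    rw [this, hp, laguerreFun_zero]
  have hsq' : Integrable fun u => p (u - v) ^ 2 := hsq.comp_sub_right v
  -- The left side is `κ |φ(v)|` by idempotence. The bound on the right equals `∫ φ²` by translation
  -- invariance, and this is `κ φ(0)` by idempotence at `v = 0`.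
  have hle : ‖∫ u, twistedIntegrand n l v (k, k) u‖ ≤ ∫ u, (p (u - v) ^ 2 + p u ^ 2) / 2 := by
    refine (norm_integral_le_integral_norm _).trans ?_
    refine integral_mono (integrable_twistedIntegrand n hl v (k, k)).norm
      ((hsq'.add hsq).div_const 2) fun u => ?_
    simp only [twistedIntegrand, norm_mul, norm_exp_I_mul, one_mul, Complex.norm_real,
      Real.norm_eq_abs]
    have := two_mul_le_add_sq |p (u - v)| |p u|
    rw [sq_abs, sq_abs] at this
    linarith
  rw [hv, Complex.norm_real, Real.norm_eq_abs, abs_mul, abs_of_pos hκ, integral_div,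
    integral_add hsq' hsq, integral_sub_right_eq_self (fun u => p u ^ 2) v, h0'] at hle
  refine le_of_mul_le_mul_left (hle.trans (le_of_eq ?_)) hκ
  ring

/-- Twisted convolution with `φ_{k,λ}`. -/
def twConv (n k : ℕ) (l : ℝ) (g : Cn n → ℂ) (w : Cn n) : ℂ := ∫ z, g z * twKer n k l w z

theorem norm_twConv_le (n k : ℕ) (l : ℝ) {g : Cn n → ℂ} (hg : Integrable g) (w : Cn n) :
    ‖twConv n k l g w‖ ≤ (∫ z, ‖g z‖) * (2 ^ (n - 1) * 8 ^ k) := by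
  rw [← integral_mul_const]
  refine norm_integral_le_of_norm_le (hg.norm.mul_const _) (Filter.Eventually.of_forall fun z => ?_)
  rw [norm_mul, norm_twKer]
  gcongr
  exact laguerreFun_bound' n k l _

theorem integrable_twConv (n k : ℕ) {l : ℝ} (hl : l ≠ 0) {g : Cn n → ℂ} (hg : Integrable g) :
    Integrable (twConv n k l g) := by
  have h := Integrable.convolution_integrand (μ := (volume : Measure (Cn n)))
    (ContinuousLinearMap.mul ℝ ℝ) hg.norm (integrable_laguerreFun n k hl)
  have h2 : Integrable (fun p : Cn n × Cn n => g p.2 * twKer n k l p.1 p.2)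
      ((volume : Measure (Cn n)).prod volume) := by
    refine h.mono ?_ (Filter.Eventually.of_forall fun p => ?_)
    · exact hg.aestronglyMeasurable.comp_snd.mul (continuous_twKer n k l).aestronglyMeasurable
    · simp [norm_twKer]
  exact h2.integral_prod_left

/-- The transpose of twisted convolution, by Fubini; the boundedness of the kernel makes the double
integral absolutely convergent. -/
theorem integral_mul_twConv (n k : ℕ) (l : ℝ) {g h : Cn n → ℂ} (hg : Integrable g)
    (hh : Integrable h) :
    ∫ w, h w * twConv n k l g w = ∫ z, g z * ∫ w, h w * twKer n k l w z := by
  have hintegr : Integrable (Function.uncurry fun w z => h w * (g z * twKer n k l w z))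
      ((volume : Measure (Cn n)).prod volume) := by
    have := (hh.mul_prod hg).mul_bdd (c := 2 ^ (n - 1) * 8 ^ k)
      (continuous_twKer n k l).aestronglyMeasurable
      (Filter.Eventually.of_forall fun p => by
        rw [norm_twKer]; exact laguerreFun_bound' n k l _)
    refine this.congr (Filter.Eventually.of_forall fun p => ?_)
    simp only [Function.uncurry]
    ring
  have := integral_integral_swap hintegr
  simp only [twConv, ← integral_const_mul]
  rw [this]
  refine integral_congr_ae (Filter.Eventually.of_forall fun z => ?_)
  simp only
  congr 1
  funext w
  ring

/-- Twisted convolution with `φ_k` behaves like `κ` times an orthogonal projection, and the ranges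
for different `k` are orthogonal. The form is the one that `sum_norm_sq_le_of_inner_eq` takes as
hypothesis. -/
theorem integral_conj_twConv_mul {n : ℕ} (hn : 1 ≤ n) (j k : ℕ) {l : ℝ} (hl : l ≠ 0)
    {g : Cn n → ℂ} (hg : Integrable g) :
    ∫ w, (starRingEnd ℂ) (twConv n j l g w) * twConv n k l g w =
      if j = k then (((2 * Real.pi / |l|) ^ n : ℝ) : ℂ) *
        ∫ w, (starRingEnd ℂ) (twConv n k l g w) * g w else 0 := by
  set κ : ℝ := (2 * Real.pi / |l|) ^ n
  have hc : Integrable fun w => (starRingEnd ℂ) (twConv n j l g w) :=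
    (Complex.conjLIE.toContinuousLinearEquiv.integrable_comp_iff).mpr (integrable_twConv n j hl hg)
  have hK : ∀ z, Integrable fun w => (starRingEnd ℂ) (twKer n k l w z) := fun z =>
    (Complex.conjLIE.toContinuousLinearEquiv.integrable_comp_iff).mpr (integrable_twKer_left n k hl z)
  have hinner : ∀ z, ∫ w, (starRingEnd ℂ) (twConv n j l g w) * twKer n k l w z =
      if j = k then (κ : ℂ) * (starRingEnd ℂ) (twConv n k l g z) else 0 := by
    intro z
    have h1 := integral_mul_twConv n j l hg (hK z)
    simp_rw [integral_conj_twKer_mul hn hl k j] at h1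
    have h2 : ∫ w, (starRingEnd ℂ) (twConv n j l g w) * twKer n k l w z =
        (starRingEnd ℂ) (∫ w, (starRingEnd ℂ) (twKer n k l w z) * twConv n j l g w) := by
      rw [← integral_conj]
      congr 1
      funext w
      rw [map_mul, Complex.conj_conj, mul_comm]
    rw [h2, h1]
    by_cases hjk : j = k
    · subst hjk
      simp only [if_true, twConv]
      rw [← Complex.conj_ofReal κ, ← map_mul, ← integral_const_mul]
      congr 2
      funext w
      rw [Complex.conj_ofReal]
      ring
    · simp [hjk, Ne.symm hjk]
  rw [integral_mul_twConv n k l hg hc]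
  simp_rw [hinner]
  split_ifs with hjk
  · rw [← integral_const_mul]
    congr 1
    funext w
    ring
  · simp

/-- A Bessel inequality for pairwise orthogonal vectors `v k` with `⟪v k, v k⟫ = κ ⟪v k, g⟫`. -/
theorem sum_norm_sq_le_of_inner_eq {H : Type*} [NormedAddCommGroup H] [InnerProductSpace ℂ H]
    {κ : ℝ} (hκ : 0 ≤ κ) (v : ℕ → H) (g : H)
    (hv : ∀ j k, inner ℂ (v j) (v k) = if j = k then (κ : ℂ) * inner ℂ (v k) g else 0)
    (s : Finset ℕ) : ∑ k ∈ s, ‖v k‖ ^ 2 ≤ κ ^ 2 * ‖g‖ ^ 2 := by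
  -- The sum inherits the relation `⟪U, U⟫ = κ ⟪U, g⟫`, so Cauchy–Schwarz gives `‖U‖ ≤ κ ‖g‖`, while
  -- orthogonality identifies `‖U‖²` with the sum of squares.
  set U : H := ∑ k ∈ s, v k with hU
  have h1 : inner ℂ U U = ∑ k ∈ s, inner ℂ (v k) (v k) := by
    rw [hU, sum_inner]
    refine Finset.sum_congr rfl fun j hj => ?_
    rw [inner_sum, Finset.sum_eq_single j]
    · intro k _ hkj
      rw [hv, if_neg (Ne.symm hkj)]
    · exact fun h => absurd hj h
  have h2 : inner ℂ U U = (κ : ℂ) * inner ℂ U g := by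
    rw [h1, hU, sum_inner, Finset.mul_sum]
    refine Finset.sum_congr rfl fun j _ => ?_
    rw [hv, if_pos rfl]
  have h3 : ∑ k ∈ s, ‖v k‖ ^ 2 = ‖U‖ ^ 2 := by
    have : ((∑ k ∈ s, ‖v k‖ ^ 2 : ℝ) : ℂ) = ((‖U‖ ^ 2 : ℝ) : ℂ) := by
      have h4 := h1
      simp only [inner_self_eq_norm_sq_to_K] at h4
      push_cast
      exact h4.symm
    exact_mod_cast this
  have h4 : ‖U‖ ^ 2 ≤ κ * (‖U‖ * ‖g‖) := by
    have h5 : ‖(inner ℂ U U : ℂ)‖ = ‖U‖ ^ 2 := by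
      rw [inner_self_eq_norm_sq_to_K]; simp
    rw [← h5, h2, norm_mul, Complex.norm_real, Real.norm_of_nonneg hκ]
    gcongr
    exact norm_inner_le_norm U g
  have h6 : ‖U‖ ≤ κ * ‖g‖ := by
    rcases (norm_nonneg U).eq_or_lt with h | h
    · rw [← h]; positivity
    · nlinarith
  rw [h3, ← mul_pow]
  gcongr

theorem lintegral_enorm_sq_eq {α : Type*} [MeasurableSpace α] {μ : Measure α} {f : α → ℂ}
    (hf : MemLp f 2 μ) : ∫⁻ x, ‖f x‖ₑ ^ 2 ∂μ = ENNReal.ofReal (‖hf.toLp f‖ ^ 2) := by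
  rw [Lp.norm_toLp, ENNReal.ofReal_pow ENNReal.toReal_nonneg, ENNReal.ofReal_toReal hf.2.ne]
  have := eLpNorm_nnreal_pow_eq_lintegral (f := f) (μ := μ) (p := 2) (by norm_num)
  simpa using this.symm

/-- The Bessel inequality for the twisted convolutions with the functions `φ_{k,λ}`. -/
theorem tsum_lintegral_twConv_le {n : ℕ} (hn : 1 ≤ n) {l : ℝ} (hl : l ≠ 0)
    {g : Cn n → ℂ} (hg : Integrable g) :
    ∑' k, ∫⁻ w, ‖twConv n k l g w‖ₑ ^ 2 ≤
      ENNReal.ofReal (((2 * Real.pi / |l|) ^ n) ^ 2) * ∫⁻ z, ‖g z‖ₑ ^ 2 := by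
  set κ : ℝ := (2 * Real.pi / |l|) ^ n with hκdef
  have hκ : 0 < κ := by
    have := abs_pos.mpr hl
    positivity
  by_cases hfin : ∫⁻ z, ‖g z‖ₑ ^ 2 = ∞
  · rw [hfin, ENNReal.mul_top (by simpa using hκ.ne')]
    exact le_top
  have hg2 : MemLp g 2 := by
    refine ⟨hg.aestronglyMeasurable, ?_⟩
    rw [eLpNorm_lt_top_iff_lintegral_rpow_enorm_lt_top (by norm_num) (by norm_num)]
    simpa using lt_top_iff_ne_top.mpr hfin
  have hu2 : ∀ k, MemLp (twConv n k l g) 2 := by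
    intro k
    have hi := integrable_twConv n k hl hg
    rw [memLp_two_iff_integrable_sq_norm hi.aestronglyMeasurable]
    simp_rw [sq]
    exact hi.norm.mul_bdd (c := (∫ z, ‖g z‖) * (2 ^ (n - 1) * 8 ^ k)) hi.norm.aestronglyMeasurable
      (Filter.Eventually.of_forall fun w => by
        rw [norm_norm]; exact norm_twConv_le n k l hg w)
  have hinner : ∀ {a b : Cn n → ℂ} (ha : MemLp a 2) (hb : MemLp b 2),
      inner ℂ (ha.toLp a) (hb.toLp b) = ∫ w, (starRingEnd ℂ) (a w) * b w := by
    intro a b ha hb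
    rw [L2.inner_def]
    refine integral_congr_ae ?_
    filter_upwards [ha.coeFn_toLp, hb.coeFn_toLp] with w h1 h2
    rw [h1, h2, RCLike.inner_apply, mul_comm]
  have hB := sum_norm_sq_le_of_inner_eq hκ.le (fun k => (hu2 k).toLp _) (hg2.toLp g)
    (fun j k => by
      rw [hinner, hinner, integral_conj_twConv_mul hn j k hl hg])
  rw [ENNReal.tsum_eq_iSup_sum]
  refine iSup_le fun s => ?_
  simp_rw [lintegral_enorm_sq_eq (hu2 _), lintegral_enorm_sq_eq hg2]
  rw [← ENNReal.ofReal_sum_of_nonneg (fun _ _ => by positivity), ← ENNReal.ofReal_mul (by positivity)]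
  exact ENNReal.ofReal_le_ofReal (hB s)

/-! ### The Plancherel bound on the real line. -/

/-- The Fourier transform `∫ h(t) e^{-iλt} dt` on the real line. -/
def fourierLine (h : ℝ → ℂ) (l : ℝ) : ℂ := ∫ t, h t * Complex.exp (-(Complex.I * l * t))

theorem norm_exp_neg_I_mul (l t : ℝ) : ‖Complex.exp (-(Complex.I * l * t))‖ = 1 := by
  rw [show -(Complex.I * l * t) = ((-(l * t) : ℝ) : ℂ) * Complex.I by push_cast; ring,
    Complex.norm_exp_ofReal_mul_I]

theorem continuous_exp_neg_I_mul :
    Continuous fun p : ℝ × ℝ => Complex.exp (-(Complex.I * p.1 * p.2)) := by fun_prop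

theorem norm_fourierLine_le (h : ℝ → ℂ) (l : ℝ) : ‖fourierLine h l‖ ≤ ∫ t, ‖h t‖ := by
  refine (norm_integral_le_integral_norm _).trans (le_of_eq ?_)
  simp [norm_exp_neg_I_mul]

theorem continuous_fourierLine {h : ℝ → ℂ} (hh : Integrable h) : Continuous (fourierLine h) := by
  refine continuous_of_dominated (bound := fun t => ‖h t‖) (fun l => ?_) (fun l => ?_) hh.norm ?_
  · exact hh.aestronglyMeasurable.mul
      (continuous_exp_neg_I_mul.comp (Continuous.prodMk_right l)).aestronglyMeasurable
  · exact Filter.Eventually.of_forall fun t => by rw [norm_mul, norm_exp_neg_I_mul, mul_one]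
  · exact Filter.Eventually.of_forall fun t => by fun_prop

theorem integral_fourierLine_mul {h H : ℝ → ℂ} (hh : Integrable h) (hH : Integrable H) :
    ∫ l, fourierLine h l * H l = ∫ t, h t * fourierLine H t := by
  have hintegr : Integrable (Function.uncurry fun l t : ℝ =>
      h t * Complex.exp (-(Complex.I * l * t)) * H l) ((volume : Measure ℝ).prod volume) := by
    have := (hH.mul_prod hh).mul_bdd (c := 1) continuous_exp_neg_I_mul.aestronglyMeasurable
      (Filter.Eventually.of_forall fun p => (norm_exp_neg_I_mul p.1 p.2).le)
    refine this.congr (Filter.Eventually.of_forall fun p => ?_)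
    simp only [Function.uncurry]
    ring
  have := integral_integral_swap hintegr
  simp only [fourierLine, ← integral_mul_const, ← integral_const_mul]
  rw [this]
  congr 1
  funext t
  congr 1
  funext l
  rw [show Complex.I * (t : ℂ) * l = Complex.I * l * t by ring]
  ring

/-- The Fourier transform of the Gaussian `e^{-ελ²}`. -/
def gaussHat (ε x : ℝ) : ℝ := √(Real.pi / ε) * Real.exp (-((4 * ε)⁻¹ * x ^ 2))

theorem fourierLine_gaussian {ε : ℝ} (hε : 0 < ε) (s t : ℝ) :
    fourierLine (fun l => (Real.exp (-(ε * l ^ 2)) : ℂ) * Complex.exp (Complex.I * l * t)) s =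
      (gaussHat ε (t - s) : ℂ) := by
  have h := fourierIntegral_gaussian (b := ε) (by simpa using hε) ((t - s : ℝ) : ℂ)
  rw [fourierLine, gaussHat]
  have e : ∀ l : ℝ, (Real.exp (-(ε * l ^ 2)) : ℂ) * Complex.exp (Complex.I * l * t) *
      Complex.exp (-(Complex.I * s * l)) =
      Complex.exp (Complex.I * ((t - s : ℝ) : ℂ) * l) * Complex.exp (-(ε : ℂ) * l ^ 2) := by
    intro l
    rw [Complex.ofReal_exp, ← Complex.exp_add, ← Complex.exp_add, ← Complex.exp_add]
    congr 1
    push_cast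
    ring
  simp_rw [e]
  rw [h, Complex.ofReal_mul, Real.sqrt_eq_rpow, Complex.ofReal_cpow (by positivity),
    Complex.ofReal_exp]
  push_cast
  congr 2
  have : (ε : ℂ) ≠ 0 := by exact_mod_cast hε.ne'
  field_simp

theorem lintegral_gaussHat {ε : ℝ} (hε : 0 < ε) :
    ∫⁻ x, ENNReal.ofReal (gaussHat ε x) = ENNReal.ofReal (2 * Real.pi) := by
  have hi : Integrable (gaussHat ε) := by
    have := (integrable_exp_neg_mul_sq (b := (4 * ε)⁻¹) (by positivity)).const_mul √(Real.pi / ε)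
    simpa only [gaussHat, neg_mul] using! this
  rw [← ofReal_integral_eq_lintegral_ofReal hi (Filter.Eventually.of_forall fun x => by
    simp only [gaussHat]; positivity)]
  congr 1
  have := integral_gaussian (4 * ε)⁻¹
  simp only [gaussHat, ← neg_mul]
  rw [integral_const_mul, this, ← Real.sqrt_mul (by positivity)]
  rw [show Real.pi / ε * (Real.pi / (4 * ε)⁻¹) = (2 * Real.pi) ^ 2 by field_simp; norm_num]
  exact Real.sqrt_sq (by positivity)

theorem two_mul_enorm_mul_le (a b : ℂ) : 2 * (‖a‖ₑ * ‖b‖ₑ) ≤ ‖a‖ₑ ^ 2 + ‖b‖ₑ ^ 2 := by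
  have := two_mul_le_add_sq ‖a‖₊ ‖b‖₊
  rw [mul_assoc] at this
  simp only [enorm_eq_nnnorm]
  exact_mod_cast this

/-- Young's inequality in the form `⟪|h|, k * |h|⟫ ≤ ‖k‖₁ ‖h‖₂²` for an even kernel. -/
theorem lintegral_enorm_mul_gaussHat_le {h : ℝ → ℂ} (hh : AEStronglyMeasurable h) {ε : ℝ}
    (hε : 0 < ε) :
    ∫⁻ t, ‖h t‖ₑ * ∫⁻ s, ‖h s‖ₑ * ENNReal.ofReal (gaussHat ε (t - s)) ≤
      ENNReal.ofReal (2 * Real.pi) * ∫⁻ t, ‖h t‖ₑ ^ 2 := by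
  set k : ℝ → ℝ≥0∞ := fun x => ENNReal.ofReal (gaussHat ε x) with hk
  have hkm : Measurable k := by
    refine ENNReal.measurable_ofReal.comp ?_
    unfold gaussHat
    fun_prop
  have hk1 : ∀ t, ∫⁻ s, k (t - s) = ENNReal.ofReal (2 * Real.pi) := fun t => by
    rw [lintegral_sub_left_eq_self k t]; exact lintegral_gaussHat hε
  have hk2 : ∀ s, ∫⁻ t, k (t - s) = ENNReal.ofReal (2 * Real.pi) := fun s => by
    rw [lintegral_sub_right_eq_self k s]; exact lintegral_gaussHat hε
  have he : AEMeasurable (fun t => ‖h t‖ₑ ^ 2) := hh.enorm.pow_const 2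
  have hks : Measurable fun p : ℝ × ℝ => k (p.1 - p.2) := hkm.comp (measurable_fst.sub measurable_snd)
  have h1 : 2 * ∫⁻ t, ‖h t‖ₑ * ∫⁻ s, ‖h s‖ₑ * k (t - s) ≤
      2 * (ENNReal.ofReal (2 * Real.pi) * ∫⁻ t, ‖h t‖ₑ ^ 2) := by
    calc 2 * ∫⁻ t, ‖h t‖ₑ * ∫⁻ s, ‖h s‖ₑ * k (t - s)
        = ∫⁻ t, ∫⁻ s, 2 * (‖h t‖ₑ * ‖h s‖ₑ) * k (t - s) := by
          rw [← lintegral_const_mul' _ _ (by norm_num)]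
          refine lintegral_congr fun t => ?_
          rw [← lintegral_const_mul' _ _ enorm_ne_top, ← lintegral_const_mul' _ _ (by norm_num)]
          refine lintegral_congr fun s => ?_
          ring
      _ ≤ ∫⁻ t, ∫⁻ s, (‖h t‖ₑ ^ 2 * k (t - s) + ‖h s‖ₑ ^ 2 * k (t - s)) := by
          refine lintegral_mono fun t => lintegral_mono fun s => ?_
          rw [← add_mul]
          -- After `2|h(t)||h(s)| ≤ |h(t)|² + |h(s)|²` each term needs only the mass `2π` of the
          -- kernel in the other variable.
          exact mul_le_mul_left (two_mul_enorm_mul_le _ _) _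
      _ = ∫⁻ t, (‖h t‖ₑ ^ 2 * ENNReal.ofReal (2 * Real.pi) + ∫⁻ s, ‖h s‖ₑ ^ 2 * k (t - s)) := by
          refine lintegral_congr fun t => ?_
          rw [lintegral_add_left (by exact (hkm.comp (measurable_const.sub measurable_id)).const_mul _),
            lintegral_const_mul' _ _ (by simp), hk1]
      _ = (∫⁻ t, ‖h t‖ₑ ^ 2 * ENNReal.ofReal (2 * Real.pi)) +
            ∫⁻ s, ∫⁻ t, ‖h s‖ₑ ^ 2 * k (t - s) := by
          rw [lintegral_add_left' (he.mul_const _), lintegral_lintegral_swap]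
          exact he.comp_snd.mul hks.aemeasurable
      _ = 2 * (ENNReal.ofReal (2 * Real.pi) * ∫⁻ t, ‖h t‖ₑ ^ 2) := by
          rw [lintegral_mul_const' _ _ (ENNReal.ofReal_ne_top)]
          have : ∀ s, ∫⁻ t, ‖h s‖ₑ ^ 2 * k (t - s) = ‖h s‖ₑ ^ 2 * ENNReal.ofReal (2 * Real.pi) := by
            intro s
            rw [lintegral_const_mul' _ _ (by simp), hk2]
          simp_rw [this]
          rw [lintegral_mul_const' _ _ (ENNReal.ofReal_ne_top)]
          ring
  exact (ENNReal.mul_le_mul_iff_right (by norm_num) (by norm_num)).mp h1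

/-- The Gaussian factor makes Fubini legitimate and turns the left side into the quadratic form of
`h` with kernel `gaussHat ε (t - s)`. Its `L¹` norm is `2π` for every `ε`, so the bound survives `ε
→ 0`. -/
theorem lintegral_fourierLine_mul_gaussian_le {h : ℝ → ℂ} (hh : Integrable h) {ε : ℝ}
    (hε : 0 < ε) :
    ∫⁻ l, ‖fourierLine h l‖ₑ ^ 2 * ENNReal.ofReal (Real.exp (-(ε * l ^ 2))) ≤
      ENNReal.ofReal (2 * Real.pi) * ∫⁻ t, ‖h t‖ₑ ^ 2 := by
  set G : ℝ → ℂ := fun l => (Real.exp (-(ε * l ^ 2)) : ℂ) with hGdef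
  have hGr : Integrable fun l : ℝ => Real.exp (-(ε * l ^ 2)) := by
    simpa only [neg_mul] using integrable_exp_neg_mul_sq hε
  have hG : Integrable G := hGr.ofReal
  have hcont := continuous_fourierLine hh
  set H : ℝ → ℂ := fun l => (starRingEnd ℂ) (fourierLine h l) * G l with hHdef
  have hH : Integrable H := hG.bdd_mul (c := ∫ t, ‖h t‖)
    (Complex.continuous_conj.comp hcont).aestronglyMeasurable
    (Filter.Eventually.of_forall fun l => by
      rw [RCLike.norm_conj]; exact norm_fourierLine_le h l)
  have hGt : ∀ t : ℝ, Integrable fun l : ℝ => G l * Complex.exp (Complex.I * l * t) := by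
    intro t
    refine hG.mul_bdd (c := 1) (by fun_prop) (Filter.Eventually.of_forall fun l => ?_)
    have := norm_exp_neg_I_mul (-l) t
    push_cast at this
    rw [← this]
    refine le_of_eq ?_
    congr 2
    ring
  have hFH : ∀ t, fourierLine H t = (starRingEnd ℂ) (∫ s, h s * (gaussHat ε (t - s) : ℂ)) := by
    intro t
    have := integral_fourierLine_mul hh (hGt t)
    simp_rw [hGdef, fourierLine_gaussian hε] at this
    rw [← this, ← integral_conj, fourierLine]
    congr 1
    funext l
    simp only [hHdef, hGdef, map_mul, Complex.conj_ofReal, ← Complex.exp_conj, Complex.conj_I]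
    rw [mul_assoc]
    congr 3
    ring
  have hmain : ∫ l, ‖fourierLine h l‖ ^ 2 * Real.exp (-(ε * l ^ 2)) ≤
      ‖∫ t, h t * fourierLine H t‖ := by
    rw [← integral_fourierLine_mul hh hH]
    have e : ∀ l, fourierLine h l * H l =
        ((‖fourierLine h l‖ ^ 2 * Real.exp (-(ε * l ^ 2)) : ℝ) : ℂ) := by
      intro l
      simp only [hHdef, hGdef]
      rw [← mul_assoc, Complex.mul_conj, Complex.normSq_eq_norm_sq]
      push_cast
      ring
    simp_rw [e]
    rw [integral_complex_ofReal, Complex.norm_real]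
    exact le_abs_self _
  have hintegr : Integrable fun l => ‖fourierLine h l‖ ^ 2 * Real.exp (-(ε * l ^ 2)) :=
    hGr.bdd_mul (c := (∫ t, ‖h t‖) ^ 2) (hcont.norm.pow 2).aestronglyMeasurable
      (Filter.Eventually.of_forall fun l => by
        rw [norm_pow, norm_norm]
        gcongr
        exact norm_fourierLine_le h l)
  calc ∫⁻ l, ‖fourierLine h l‖ₑ ^ 2 * ENNReal.ofReal (Real.exp (-(ε * l ^ 2)))
      = ENNReal.ofReal (∫ l, ‖fourierLine h l‖ ^ 2 * Real.exp (-(ε * l ^ 2))) := by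
        rw [ofReal_integral_eq_lintegral_ofReal hintegr
          (Filter.Eventually.of_forall fun l => by positivity)]
        refine lintegral_congr fun l => ?_
        rw [ENNReal.ofReal_mul (by positivity), ENNReal.ofReal_pow (norm_nonneg _), ofReal_norm]
    _ ≤ ENNReal.ofReal ‖∫ t, h t * fourierLine H t‖ := ENNReal.ofReal_le_ofReal hmain
    _ ≤ ∫⁻ t, ‖h t * fourierLine H t‖ₑ := by
        rw [ofReal_norm]
        exact enorm_integral_le_lintegral_enorm _
    _ ≤ ∫⁻ t, ‖h t‖ₑ * ∫⁻ s, ‖h s‖ₑ * ENNReal.ofReal (gaussHat ε (t - s)) := by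
        refine lintegral_mono fun t => ?_
        rw [enorm_mul, hFH, RCLike.enorm_conj]
        refine mul_le_mul_right ((enorm_integral_le_lintegral_enorm _).trans (le_of_eq ?_)) _
        refine lintegral_congr fun s => ?_
        rw [enorm_mul, ← ofReal_norm (gaussHat ε (t - s) : ℂ), Complex.norm_real,
          Real.norm_of_nonneg (by simp only [gaussHat]; positivity)]
    _ ≤ _ := lintegral_enorm_mul_gaussHat_le hh.aestronglyMeasurable hε

/-- The Plancherel bound on the real line for integrable functions. -/
theorem lintegral_fourierLine_le {h : ℝ → ℂ} (hh : Integrable h) :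
    ∫⁻ l, ‖fourierLine h l‖ₑ ^ 2 ≤ ENNReal.ofReal (2 * Real.pi) * ∫⁻ t, ‖h t‖ₑ ^ 2 := by
  -- The Gaussian damping is removed along this sequence with Fatou's lemma.
  set ε : ℕ → ℝ := fun m => 1 / ((m : ℝ) + 1) with hε
  have hε0 : ∀ m, 0 < ε m := fun m => by simp only [hε]; positivity
  have hlim : ∀ l : ℝ, Filter.Tendsto
      (fun m => ‖fourierLine h l‖ₑ ^ 2 * ENNReal.ofReal (Real.exp (-(ε m * l ^ 2))))
      Filter.atTop (nhds (‖fourierLine h l‖ₑ ^ 2)) := by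
    intro l
    have h1 : Filter.Tendsto (fun m => Real.exp (-(ε m * l ^ 2))) Filter.atTop (nhds 1) := by
      have := (tendsto_one_div_add_atTop_nhds_zero_nat (𝕜 := ℝ)).mul_const (l ^ 2)
      have := (Real.continuous_exp.tendsto _).comp this.neg
      simpa [hε, Function.comp_def] using this
    have h2 := ENNReal.Tendsto.const_mul (a := ‖fourierLine h l‖ₑ ^ 2)
      (ENNReal.tendsto_ofReal h1) (Or.inr (by simp))
    simpa using h2
  calc ∫⁻ l, ‖fourierLine h l‖ₑ ^ 2
      = ∫⁻ l, Filter.liminf (fun m => ‖fourierLine h l‖ₑ ^ 2 *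
          ENNReal.ofReal (Real.exp (-(ε m * l ^ 2)))) Filter.atTop :=
        lintegral_congr fun l => (hlim l).liminf_eq.symm
    _ ≤ Filter.liminf (fun m => ∫⁻ l, ‖fourierLine h l‖ₑ ^ 2 *
          ENNReal.ofReal (Real.exp (-(ε m * l ^ 2)))) Filter.atTop := by
        refine lintegral_liminf_le fun m => ?_
        exact ((continuous_fourierLine hh).measurable.enorm.pow_const 2).mul (by fun_prop)
    _ ≤ _ := by
        refine Filter.liminf_le_of_le (by isBoundedDefault) fun b hb => ?_
        obtain ⟨m, hm⟩ := hb.exists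
        exact hm.trans (lintegral_fourierLine_mul_gaussian_le hh (hε0 m))

/-! ### The transform along one ray and its square-integral bound. -/

/-- The unnormalized transform along the ray `R_k`. -/
def rayTrans (n k : ℕ) (f : Hn n → ℂ) (l : ℝ) (w : Cn n) : ℂ :=
  ∫ p : Hn n, f p * eigenFun n k l (mul (inv p) (w, 0))

/-- The central variable enters only through a character. The transform on a ray is therefore a
Fourier transform in `t` followed by a twisted convolution in `z`. -/
theorem eigenFun_mul_inv (n k : ℕ) (l : ℝ) (w : Cn n) (p : Hn n) :
    eigenFun n k l (mul (inv p) (w, 0)) =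
      Complex.exp (-(Complex.I * l * p.2)) * twKer n k l w p.1 := by
  have h : (∑ j, (-p.1) j * (starRingEnd ℂ) (w j)).im = -sympl p.1 w := by
    simp [sympl]
  simp only [eigenFun, mul, inv, h, twKer]
  rw [← mul_assoc, ← Complex.exp_add, neg_add_eq_sub p.1 w]
  congr 2
  push_cast
  ring

theorem norm_eigenFun (n k : ℕ) (l : ℝ) (p : Hn n) :
    ‖eigenFun n k l p‖ = |laguerreFun n k l p.1| := by
  have := norm_exp_neg_I_mul (-l) p.2
  rw [eigenFun, norm_mul, Complex.norm_real, Real.norm_eq_abs,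
    show Complex.I * l * p.2 = -(Complex.I * ((-l : ℝ) : ℂ) * p.2) by push_cast; ring, this, one_mul]

theorem continuous_twKer_param (n k : ℕ) :
    Continuous fun q : (ℝ × Cn n) × Cn n => twKer n k q.1.1 q.1.2 q.2 := by
  have h1 : Continuous fun q : (ℝ × Cn n) × Cn n => sympl q.2 q.1.2 :=
    continuous_sympl.comp (continuous_snd.prodMk (continuous_snd.comp continuous_fst))
  have h2 : Continuous fun q : (ℝ × Cn n) × Cn n => laguerreFun n k q.1.1 (q.1.2 - q.2) :=
    (continuous_laguerreFun n k).comp (Continuous.prodMk (continuous_fst.comp continuous_fst)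
      ((continuous_snd.comp continuous_fst).sub continuous_snd))
  have h3 : Continuous fun q : (ℝ × Cn n) × Cn n => q.1.1 := continuous_fst.comp continuous_fst
  unfold twKer
  refine Continuous.mul (Complex.continuous_exp.comp ?_) (Complex.continuous_ofReal.comp h2)
  exact (((continuous_const.mul (Complex.continuous_ofReal.comp h3)).mul
    (Complex.continuous_ofReal.comp h1)).div_const 2).neg

theorem continuous_eigenFun_param (n k : ℕ) :
    Continuous fun q : (ℝ × Cn n) × Hn n => eigenFun n k q.1.1 (mul (inv q.2) (q.1.2, 0)) := by
  simp_rw [eigenFun_mul_inv]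
  refine Continuous.mul ?_ ((continuous_twKer_param n k).comp
    (f := fun q : (ℝ × Cn n) × Hn n => (q.1, q.2.1)) (by fun_prop))
  exact continuous_exp_neg_I_mul.comp
    (f := fun q : (ℝ × Cn n) × Hn n => (q.1.1, q.2.2)) (by fun_prop)

theorem continuous_eigenFun_mul_inv (n k : ℕ) (l : ℝ) (w : Cn n) :
    Continuous fun p : Hn n => eigenFun n k l (mul (inv p) (w, 0)) :=
  (continuous_eigenFun_param n k).comp (Continuous.prodMk_right (l, w))

theorem integrable_mul_eigenFun (n k : ℕ) (l : ℝ) (w : Cn n) {f : Hn n → ℂ} (hf : Integrable f) :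
    Integrable fun p : Hn n => f p * eigenFun n k l (mul (inv p) (w, 0)) :=
  hf.mul_bdd (c := 2 ^ (n - 1) * 8 ^ k) (continuous_eigenFun_mul_inv n k l w).aestronglyMeasurable
    (Filter.Eventually.of_forall fun p => by
      rw [norm_eigenFun]; exact laguerreFun_bound' n k l _)

theorem stronglyMeasurable_rayTrans (n k : ℕ) {f : Hn n → ℂ} (hf : StronglyMeasurable f) :
    StronglyMeasurable fun q : ℝ × Cn n => rayTrans n k f q.1 q.2 :=
  StronglyMeasurable.integral_prod_right'
    (f := fun q : (ℝ × Cn n) × Hn n => f q.2 * eigenFun n k q.1.1 (mul (inv q.2) (q.1.2, 0)))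
    ((hf.comp_measurable measurable_snd).mul (continuous_eigenFun_param n k).stronglyMeasurable)

/-- The Fourier transform of `f` in the central variable. -/
def centralFourier {n : ℕ} (f : Hn n → ℂ) (l : ℝ) (z : Cn n) : ℂ :=
  fourierLine (fun t => f (z, t)) l

theorem integrable_mul_exp {n : ℕ} {f : Hn n → ℂ} (hf : Integrable f) (l : ℝ) :
    Integrable (fun p : Hn n => f p * Complex.exp (-(Complex.I * l * p.2)))
      ((volume : Measure (Cn n)).prod volume) :=
  Integrable.mul_bdd (c := 1) hf
    (continuous_exp_neg_I_mul.comp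
      (f := fun p : Hn n => (l, p.2)) (by fun_prop)).aestronglyMeasurable
    (Filter.Eventually.of_forall fun p => (norm_exp_neg_I_mul l p.2).le)

theorem integrable_centralFourier {n : ℕ} {f : Hn n → ℂ} (hf : Integrable f) (l : ℝ) :
    Integrable (centralFourier f l) :=
  (integrable_mul_exp hf l).integral_prod_left

theorem stronglyMeasurable_centralFourier {n : ℕ} {f : Hn n → ℂ} (hf : StronglyMeasurable f) :
    StronglyMeasurable fun q : ℝ × Cn n => centralFourier f q.1 q.2 := by
  refine StronglyMeasurable.integral_prod_right'
    (f := fun q : (ℝ × Cn n) × ℝ => f (q.1.2, q.2) * Complex.exp (-(Complex.I * q.1.1 * q.2))) ?_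
  refine StronglyMeasurable.mul (hf.comp_measurable (by fun_prop)) ?_
  exact (continuous_exp_neg_I_mul.comp
    (f := fun q : (ℝ × Cn n) × ℝ => (q.1.1, q.2)) (by fun_prop)).stronglyMeasurable

theorem rayTrans_eq_twConv (n k : ℕ) (l : ℝ) (w : Cn n) {f : Hn n → ℂ} (hf : Integrable f) :
    rayTrans n k f l w = twConv n k l (centralFourier f l) w := by
  rw [rayTrans, Measure.volume_eq_prod, integral_prod _ (integrable_mul_eigenFun n k l w hf)]
  simp only [twConv, centralFourier, fourierLine]
  congr 1
  funext z
  rw [← integral_mul_const]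
  congr 1
  funext t
  rw [eigenFun_mul_inv]
  ring

theorem lintegral_centralFourier_le {n : ℕ} {f : Hn n → ℂ} (hfm : StronglyMeasurable f)
    (hf : Integrable f) :
    ∫⁻ l, ∫⁻ z, ‖centralFourier f l z‖ₑ ^ 2 ≤
      ENNReal.ofReal (2 * Real.pi) * ∫⁻ p, ‖f p‖ₑ ^ 2 := by
  have hm : Measurable fun q : ℝ × Cn n => ‖centralFourier f q.1 q.2‖ₑ ^ 2 :=
    (stronglyMeasurable_centralFourier hfm).measurable.enorm.pow_const 2
  rw [lintegral_lintegral_swap hm.aemeasurable, Measure.volume_eq_prod,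
    lintegral_prod _ (hfm.measurable.enorm.pow_const 2).aemeasurable,
    ← lintegral_const_mul' _ _ ENNReal.ofReal_ne_top]
  refine lintegral_mono_ae ?_
  filter_upwards [Integrable.prod_right_ae hf] with z hz
  exact lintegral_fourierLine_le hz

/-- The square-integral bound for the transform, with the normalizing constants cancelled. -/
theorem tsum_lintegral_rayTrans_le {n : ℕ} (hn : 1 ≤ n) {f : Hn n → ℂ}
    (hfm : StronglyMeasurable f) (hf : Integrable f) :
    ∑' k, ∫⁻ l, ENNReal.ofReal (((2 * Real.pi) ^ (2 * n + 1))⁻¹ * |l| ^ (2 * n)) *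
        ∫⁻ w, ‖rayTrans n k f l w‖ₑ ^ 2 ≤ ∫⁻ p, ‖f p‖ₑ ^ 2 := by
  have hm : ∀ k, Measurable fun l => ∫⁻ w, ‖rayTrans n k f l w‖ₑ ^ 2 := fun k =>
    Measurable.lintegral_prod_right'
      ((stronglyMeasurable_rayTrans n k hfm).measurable.enorm.pow_const 2)
  have hm' : ∀ k, AEMeasurable fun l =>
      ENNReal.ofReal (((2 * Real.pi) ^ (2 * n + 1))⁻¹ * |l| ^ (2 * n)) *
        ∫⁻ w, ‖rayTrans n k f l w‖ₑ ^ 2 := fun k =>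
    (Measurable.mul (by fun_prop) (hm k)).aemeasurable
  rw [← lintegral_tsum hm']
  have h2π : (0 : ℝ) < 2 * Real.pi := by positivity
  -- The weight `(2π)^{-2n-1} |λ|^{2n}` times the Bessel constant `κ² = (2π/|λ|)^{2n}` is `1/(2π)`,
  -- which cancels the Plancherel constant of the central variable.
  calc _ ≤ ∫⁻ l, ENNReal.ofReal (2 * Real.pi)⁻¹ * ∫⁻ z, ‖centralFourier f l z‖ₑ ^ 2 := by
        refine lintegral_mono_ae ?_
        have hne : ∀ᵐ l : ℝ, l ≠ 0 := by simp [ae_iff]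
        filter_upwards [hne] with l hl
        rw [ENNReal.tsum_mul_left]
        simp_rw [rayTrans_eq_twConv n _ l _ hf]
        refine (mul_le_mul_right
          (tsum_lintegral_twConv_le hn hl (integrable_centralFourier hf l)) _).trans
          (le_of_eq ?_)
        rw [← mul_assoc, ← ENNReal.ofReal_mul (by positivity)]
        congr 2
        have hL : |l| ≠ 0 := abs_ne_zero.mpr hl
        rw [← pow_mul, div_pow, mul_comm n 2, pow_succ]
        field_simp
    _ ≤ _ := by
        rw [lintegral_const_mul' _ _ ENNReal.ofReal_ne_top]
        refine (mul_le_mul_right (lintegral_centralFourier_le hfm hf) _).trans (le_of_eq ?_)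
        rw [← mul_assoc, ← ENNReal.ofReal_mul (by positivity), inv_mul_cancel₀ h2π.ne']
        simp

/-! ### The measure on the fan, measurability, and the two bounds for the transform. -/

/-- The density of `ν₂` on the ray `R_k`. -/
def rayDensity (n k : ℕ) (l : ℝ) : ℝ≥0∞ :=
  ENNReal.ofReal (((2 * Real.pi) ^ (2 * n + 1))⁻¹ *
    (((k + n - 1)! : ℝ) / ((k ! : ℝ) * ((n - 1)! : ℝ))) ^ 2 * |l| ^ (2 * n))

theorem measurable_rayDensity (n k : ℕ) : Measurable (rayDensity n k) := by
  unfold rayDensity; fun_prop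

theorem nuTwo_eq (n : ℕ) : nuTwo n = Measure.sum fun k : ℕ =>
    Measure.map (rayPoint n k) ((volume : Measure ℝ).withDensity (rayDensity n k)) := rfl

theorem measurable_rayPoint (n k : ℕ) : Measurable (rayPoint n k) := by
  refine Measurable.subtype_mk ?_
  fun_prop

instance (n : ℕ) : SFinite (nuTwo n) := by
  unfold nuTwo; infer_instance

instance (n : ℕ) : SFinite (freqMeasure n) := by
  unfold freqMeasure; infer_instance

theorem lintegral_freqMeasure (n : ℕ) {F : fan n × Cn n → ℝ≥0∞} (hF : Measurable F) :
    ∫⁻ x, F x ∂(freqMeasure n) =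
      ∑' k, ∫⁻ l, rayDensity n k l * ∫⁻ w, F (rayPoint n k l, w) := by
  have hG : Measurable fun a => ∫⁻ w, F (a, w) := hF.lintegral_prod_right'
  rw [freqMeasure, lintegral_prod _ hF.aemeasurable, nuTwo_eq, lintegral_sum_measure]
  congr 1
  funext k
  rw [lintegral_map hG (measurable_rayPoint n k)]
  exact lintegral_withDensity_eq_lintegral_mul _ (measurable_rayDensity n k)
    (hG.comp (measurable_rayPoint n k))

theorem ae_fst_ne_zero (n : ℕ) : ∀ᵐ x ∂(freqMeasure n), x.1.1.1 ≠ 0 := by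
  have h : ∀ᵐ a ∂(nuTwo n), a.1.1 ≠ 0 := by
    have hs : MeasurableSet {a : fan n | a.1.1 ≠ 0} :=
      (measurableSet_singleton (0 : ℝ)).compl.preimage (measurable_subtype_coe.fst)
    rw [nuTwo_eq, Measure.ae_sum_iff' hs]
    intro k
    rw [ae_map_iff (measurable_rayPoint n k).aemeasurable hs]
    refine (withDensity_absolutelyContinuous _ _).ae_le ?_
    have hne : ∀ᵐ l : ℝ, l ≠ 0 := by simp [ae_iff]
    exact hne
  exact Measure.quasiMeasurePreserving_fst.ae h

theorem exists_eq_rayPoint {n : ℕ} (a : fan n) (ha : a.1.1 ≠ 0) :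
    a = rayPoint n (rayIndex a) a.1.1 := by
  rcases a.2 with ⟨k, _, h⟩ | ⟨h, _⟩
  · have e : a = rayPoint n k a.1.1 := Subtype.ext (Prod.ext rfl h)
    have hk : rayIndex a = k := by
      conv_lhs => rw [e]
      exact rayIndex_rayPoint n k ha
    rw [hk]
    exact e
  · exact absurd h ha

/-- A measurable formula for the index of a ray. -/
def rayFloor {n : ℕ} (a : fan n) : ℕ := ⌊(a.1.2 / |a.1.1| - n) / 2⌋₊

theorem measurable_rayFloor (n : ℕ) : Measurable (rayFloor : fan n → ℕ) := by
  unfold rayFloor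
  exact Nat.measurable_floor.comp (by fun_prop)

theorem rayFloor_eq {n : ℕ} (a : fan n) (ha : a.1.1 ≠ 0) : rayFloor a = rayIndex a := by
  have h : a.1.2 = (2 * rayIndex a + n) * |a.1.1| :=
    congrArg (fun b : fan n => b.1.2) (exists_eq_rayPoint a ha)
  rw [rayFloor, h, mul_div_cancel_right₀ _ (abs_ne_zero.mpr ha), add_sub_cancel_right,
    mul_div_cancel_left₀ _ (by norm_num), Nat.floor_natCast]

/-- The constant `c_{n,k}`. -/
def rayConst (n k : ℕ) : ℂ := (k ! : ℂ) * ((n - 1)! : ℂ) / ((k + n - 1)! : ℂ)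

theorem normStrichartz_eq {n : ℕ} (f : Hn n → ℂ) (x : fan n × Cn n) (hx : x.1.1.1 ≠ 0) :
    normStrichartz f x = rayConst n (rayIndex x.1) * rayTrans n (rayIndex x.1) f x.1.1.1 x.2 := by
  rw [normStrichartz, if_pos hx, strichartz, if_pos hx]
  rfl

/-- A measurable version of the normalized Strichartz transform. -/
def floorTrans {n : ℕ} (f : Hn n → ℂ) (x : fan n × Cn n) : ℂ :=
  rayConst n (rayFloor x.1) * rayTrans n (rayFloor x.1) f x.1.1.1 x.2

theorem normStrichartz_eq_floorTrans {n : ℕ} (f : Hn n → ℂ) (x : fan n × Cn n)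
    (hx : x.1.1.1 ≠ 0) : normStrichartz f x = floorTrans f x := by
  rw [normStrichartz_eq f x hx, floorTrans, rayFloor_eq _ hx]

theorem normStrichartz_ae_eq {n : ℕ} (f : Hn n → ℂ) :
    normStrichartz f =ᵐ[freqMeasure n] floorTrans f := by
  filter_upwards [ae_fst_ne_zero n] with x hx using normStrichartz_eq_floorTrans f x hx

theorem measurable_floorTrans {n : ℕ} {f : Hn n → ℂ} (hf : StronglyMeasurable f) :
    Measurable (floorTrans f) := by
  have h : Measurable fun q : ℕ × (ℝ × Cn n) => rayConst n q.1 * rayTrans n q.1 f q.2.1 q.2.2 :=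
    -- The ray index takes countably many values, so joint measurability may be checked one ray at a
    -- time.
    measurable_from_prod_countable_right fun k =>
      (stronglyMeasurable_rayTrans n k hf).measurable.const_mul (rayConst n k)
  refine h.comp (f := fun x : fan n × Cn n => (rayFloor x.1, (x.1.1.1, x.2))) ?_
  exact ((measurable_rayFloor n).comp measurable_fst).prodMk (by fun_prop)

theorem norm_rayConst (n k : ℕ) :
    ‖rayConst n k‖ = (k ! : ℝ) * ((n - 1)! : ℝ) / ((k + n - 1)! : ℝ) := by
  simp [rayConst]

/-- The binomial coefficient is the value of the Laguerre function at the origin, hence its maximum: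
`c_{n,k}` normalizes the eigenfunctions to supremum 1. -/
theorem norm_rayConst_mul_choose {n : ℕ} (hn : 1 ≤ n) (k : ℕ) :
    ‖rayConst n k‖ * ((k + (n - 1)).choose k : ℝ) = 1 := by
  have h : ((k + (n - 1)).choose k : ℝ) * ((k ! : ℝ) * ((n - 1)! : ℝ)) = ((k + (n - 1))! : ℝ) := by
    have := Nat.add_choose_mul_factorial_mul_factorial k (n - 1)
    rw [Nat.choose_symm_add, mul_assoc] at *
    exact_mod_cast this
  rw [norm_rayConst, Nat.add_sub_assoc hn, ← h]
  have h1 : (k ! : ℝ) ≠ 0 := by positivity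
  have h2 : ((n - 1)! : ℝ) ≠ 0 := by positivity
  have h3 : ((k + (n - 1)).choose k : ℝ) ≠ 0 := by
    have := Nat.choose_pos (Nat.le_add_right k (n - 1))
    positivity
  field_simp

theorem norm_normStrichartz_le {n : ℕ} (hn : 1 ≤ n) {f : Hn n → ℂ} (hf : Integrable f)
    (x : fan n × Cn n) (hx : x.1.1.1 ≠ 0) : ‖normStrichartz f x‖ ≤ ∫ p, ‖f p‖ := by
  set k := rayIndex x.1
  rw [normStrichartz_eq f x hx, norm_mul]
  calc _ ≤ ‖rayConst n k‖ * ∫ p, ‖f p‖ * ((k + (n - 1)).choose k : ℝ) := by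
        gcongr
        refine norm_integral_le_of_norm_le (hf.norm.mul_const _)
          (Filter.Eventually.of_forall fun p => ?_)
        rw [norm_mul, norm_eigenFun]
        gcongr
        exact abs_laguerreFun_le hn k hx _
    _ = _ := by
        rw [integral_mul_const, mul_left_comm, norm_rayConst_mul_choose hn, mul_one]

/-- The factor `c_{n,k}^{-2}` in `ν₂` cancels the `c_{n,k}²` from the normalization, which leaves
`tsum_lintegral_rayTrans_le`. -/
theorem lintegral_normStrichartz_le {n : ℕ} (hn : 1 ≤ n) {f : Hn n → ℂ}
    (hfm : StronglyMeasurable f) (hf : Integrable f) :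
    ∫⁻ x, ‖normStrichartz f x‖ₑ ^ 2 ∂(freqMeasure n) ≤ ∫⁻ p, ‖f p‖ₑ ^ 2 := by
  have hae : (fun x => ‖normStrichartz f x‖ₑ ^ 2) =ᵐ[freqMeasure n]
      fun x => ‖floorTrans f x‖ₑ ^ 2 := by
    filter_upwards [normStrichartz_ae_eq f] with x hx
    rw [hx]
  rw [lintegral_congr_ae hae,
    lintegral_freqMeasure n ((measurable_floorTrans hfm).enorm.pow_const 2)]
  refine le_trans (le_of_eq ?_) (tsum_lintegral_rayTrans_le hn hfm hf)
  congr 1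
  funext k
  have hne : ∀ᵐ l : ℝ, l ≠ 0 := by simp [ae_iff]
  refine lintegral_congr_ae ?_
  filter_upwards [hne] with l hl
  have e : ∀ w, floorTrans f (rayPoint n k l, w) = rayConst n k * rayTrans n k f l w := by
    intro w
    have h1 : rayFloor (rayPoint n k l) = k := by
      rw [rayFloor_eq _ (by exact hl), rayIndex_rayPoint n k hl]
    simp only [floorTrans, h1]
    rfl
  simp_rw [e, enorm_mul, mul_pow]
  rw [lintegral_const_mul' _ _ (by simp), ← mul_assoc]
  congr 1
  rw [rayDensity, ← ofReal_norm, norm_rayConst, ← ENNReal.ofReal_pow (by positivity),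
    ← ENNReal.ofReal_mul (by positivity)]
  congr 1
  have h1 : (k ! : ℝ) ≠ 0 := by positivity
  have h2 : ((n - 1)! : ℝ) ≠ 0 := by positivity
  have h3 : ((k + n - 1)! : ℝ) ≠ 0 := by positivity
  field_simp
  rw [mul_pow]

theorem normStrichartz_congr {n : ℕ} {f g : Hn n → ℂ} (h : f =ᵐ[volume] g) (x : fan n × Cn n) :
    normStrichartz f x = normStrichartz g x := by
  have h1 : ∀ u : Hn n → ℂ, ∫ p, f p * u p = ∫ p, g p * u p := fun u =>
    integral_congr_ae (h.mono fun p hp => by simp only [hp])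
  simp only [normStrichartz, strichartz, h1]

theorem normStrichartz_add {n : ℕ} {f g : Hn n → ℂ} (hf : Integrable f) (hg : Integrable g)
    (x : fan n × Cn n) (hx : x.1.1.1 ≠ 0) :
    normStrichartz (fun p => f p + g p) x = normStrichartz f x + normStrichartz g x := by
  simp only [normStrichartz_eq _ x hx, rayTrans, add_mul]
  rw [integral_add (integrable_mul_eigenFun n _ _ _ hf) (integrable_mul_eigenFun n _ _ _ hg),
    mul_add]

theorem normStrichartz_smul {n : ℕ} (c : ℂ) (f : Hn n → ℂ)
    (x : fan n × Cn n) (hx : x.1.1.1 ≠ 0) :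
    normStrichartz (fun p => c * f p) x = c * normStrichartz f x := by
  simp only [normStrichartz_eq _ x hx, rayTrans, mul_assoc]
  rw [integral_const_mul]
  ring

/-! ### Extension to `L²` by density. -/

/-- The subspace `L¹ ∩ L²` of `L²(ℍⁿ)`. -/
def integrableSubmodule (n : ℕ) : Submodule ℂ (Lp ℂ 2 (volume : Measure (Hn n))) where
  carrier := {f | Integrable (f : Hn n → ℂ) volume}
  add_mem' {f g} hf hg := (hf.add hg).congr (Lp.coeFn_add f g).symm
  zero_mem' := (integrable_zero _ _ _).congr (Lp.coeFn_zero ℂ 2 volume).symm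
  smul_mem' c f hf := (Integrable.smul c hf).congr (Lp.coeFn_smul c f).symm

theorem dense_integrableSubmodule (n : ℕ) :
    Dense (integrableSubmodule n : Set (Lp ℂ 2 (volume : Measure (Hn n)))) := by
  refine (Lp.simpleFunc.dense (E := ℂ) (μ := (volume : Measure (Hn n))) (p := 2)
    (by norm_num)).mono fun f hf => ?_
  have hi := (SimpleFunc.memLp_iff_integrable (p := 2) (by norm_num) (by norm_num)).mp
    (Lp.simpleFunc.memLp ⟨f, hf⟩)
  exact hi.congr (Lp.simpleFunc.toSimpleFunc_eq_toFun ⟨f, hf⟩)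

theorem memLp_normStrichartz {n : ℕ} (hn : 1 ≤ n) {f : Lp ℂ 2 (volume : Measure (Hn n))}
    (hf : Integrable (f : Hn n → ℂ) volume) :
    MemLp (normStrichartz (f : Hn n → ℂ)) 2 (freqMeasure n) := by
  refine ⟨(measurable_floorTrans (Lp.stronglyMeasurable f)).aestronglyMeasurable.congr
    (normStrichartz_ae_eq _).symm, ?_⟩
  rw [eLpNorm_lt_top_iff_lintegral_rpow_enorm_lt_top (by norm_num) (by norm_num)]
  have h1 := lintegral_normStrichartz_le hn (Lp.stronglyMeasurable f) hf
  have h2 := lintegral_rpow_enorm_lt_top_of_eLpNorm_lt_top (p := 2) (by norm_num) (by norm_num)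
    (Lp.memLp f).2
  have h3 := h1.trans_lt (by simpa using h2)
  simpa using h3

theorem norm_toLp_normStrichartz_le {n : ℕ} (hn : 1 ≤ n)
    {f : Lp ℂ 2 (volume : Measure (Hn n))} (hf : Integrable (f : Hn n → ℂ) volume) :
    ‖(memLp_normStrichartz hn hf).toLp _‖ ≤ ‖f‖ := by
  have h1 := lintegral_normStrichartz_le hn (Lp.stronglyMeasurable f) hf
  rw [lintegral_enorm_sq_eq (memLp_normStrichartz hn hf), lintegral_enorm_sq_eq (Lp.memLp f),
    Lp.toLp_coeFn, ENNReal.ofReal_le_ofReal_iff (by positivity)] at h1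
  exact (sq_le_sq₀ (norm_nonneg _) (norm_nonneg _)).mp h1

/-- The normalized Strichartz transform on `L¹ ∩ L²`. -/
def strichartzCore {n : ℕ} (hn : 1 ≤ n) : integrableSubmodule n →ₗ[ℂ] Lp ℂ 2 (freqMeasure n) where
  toFun f := (memLp_normStrichartz hn f.2).toLp _
  map_add' f g := by
    rw [← MemLp.toLp_add, MemLp.toLp_eq_toLp_iff]
    -- Linearity is needed only almost everywhere, so the null ray `R_∞` with its Bessel formula can
    -- be discarded.
    filter_upwards [ae_fst_ne_zero n] with x hx
    rw [Pi.add_apply, ← normStrichartz_add f.2 g.2 x hx]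
    exact normStrichartz_congr (Lp.coeFn_add _ _) x
  map_smul' c f := by
    rw [RingHom.id_apply, ← MemLp.toLp_const_smul, MemLp.toLp_eq_toLp_iff]
    filter_upwards [ae_fst_ne_zero n] with x hx
    rw [Pi.smul_apply, smul_eq_mul, ← normStrichartz_smul c _ x hx]
    exact normStrichartz_congr (Lp.coeFn_smul _ _) x

theorem IsStrichartzL2.apply_eq {n : ℕ} (hn : 1 ≤ n)
    {T : Lp ℂ 2 (volume : Measure (Hn n)) →L[ℂ] Lp ℂ 2 (freqMeasure n)} (hT : IsStrichartzL2 T)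
    (f : integrableSubmodule n) : T f = strichartzCore hn f := by
  refine Lp.ext ((hT f f.2).trans ?_)
  exact (MemLp.coeFn_toLp (memLp_normStrichartz hn f.2)).symm

theorem exists_isStrichartzL2 {n : ℕ} (hn : 1 ≤ n) :
    ∃ T : Lp ℂ 2 (volume : Measure (Hn n)) →L[ℂ] Lp ℂ 2 (freqMeasure n), IsStrichartzL2 T := by
  have hd : DenseRange (integrableSubmodule n).subtype := by
    rw [DenseRange, Submodule.coe_subtype, Subtype.range_coe]
    exact dense_integrableSubmodule n
  have hb : ∀ f : integrableSubmodule n,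
      ‖strichartzCore hn f‖ ≤ 1 * ‖(integrableSubmodule n).subtype f‖ := fun f => by
    rw [one_mul]
    exact norm_toLp_normStrichartz_le hn f.2
  refine ⟨(strichartzCore hn).extendOfNorm (integrableSubmodule n).subtype, fun f hf => ?_⟩
  have h := LinearMap.extendOfNorm_eq (f := strichartzCore hn) hd ⟨1, hb⟩ ⟨f, hf⟩
  rw [Submodule.subtype_apply] at h
  rw [h]
  exact MemLp.coeFn_toLp (memLp_normStrichartz hn hf)

theorem IsStrichartzL2.unique {n : ℕ} (hn : 1 ≤ n)
    {S T : Lp ℂ 2 (volume : Measure (Hn n)) →L[ℂ] Lp ℂ 2 (freqMeasure n)}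
    (hS : IsStrichartzL2 S) (hT : IsStrichartzL2 T) : S = T := by
  refine ContinuousLinearMap.ext fun f => ?_
  refine congrFun (Continuous.ext_on (dense_integrableSubmodule n) S.continuous T.continuous ?_) f
  intro g hg
  exact (hS.apply_eq hn ⟨g, hg⟩).trans (hT.apply_eq hn ⟨g, hg⟩).symm

theorem IsStrichartzL2.norm_apply_le {n : ℕ} (hn : 1 ≤ n)
    {T : Lp ℂ 2 (volume : Measure (Hn n)) →L[ℂ] Lp ℂ 2 (freqMeasure n)} (hT : IsStrichartzL2 T)
    (f : Lp ℂ 2 (volume : Measure (Hn n))) : ‖T f‖ ≤ ‖f‖ := by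
  have hc : IsClosed {f | ‖T f‖ ≤ ‖f‖} := isClosed_le T.continuous.norm continuous_norm
  refine (dense_integrableSubmodule n).induction (P := fun f => ‖T f‖ ≤ ‖f‖) (fun g hg => ?_) hc f
  rw [hT.apply_eq hn ⟨g, hg⟩]
  exact norm_toLp_normStrichartz_le hn hg

/-! ### Korányi balls and the weighted norm. -/

theorem koranyi_nonneg {n : ℕ} (p : Hn n) : 0 ≤ koranyi p := by
  unfold koranyi; positivity

theorem measurable_koranyi {n : ℕ} : Measurable (koranyi : Hn n → ℝ) := by
  have h : Continuous fun p : Hn n => cnorm p.1 ^ 4 + p.2 ^ 2 := by fun_prop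
  exact h.measurable.pow_const _

theorem koranyi_pow_four {n : ℕ} (p : Hn n) : koranyi p ^ 4 = cnorm p.1 ^ 4 + p.2 ^ 2 := by
  rw [koranyi, ← Real.rpow_natCast, ← Real.rpow_mul (by positivity)]
  norm_num

theorem koranyi_pos_ae (n : ℕ) : ∀ᵐ p : Hn n, 0 < koranyi p := by
  have h : ∀ᵐ t : ℝ, t ≠ 0 := by simp [ae_iff]
  have h' : ∀ᵐ p : Hn n, p.2 ≠ 0 := Measure.quasiMeasurePreserving_snd.ae h
  filter_upwards [h'] with p hp
  refine (koranyi_nonneg p).lt_of_ne fun h0 => hp ?_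
  have := koranyi_pow_four p
  rw [← h0] at this
  have h1 : 0 ≤ cnorm p.1 ^ 4 := by positivity
  have h2 : 0 ≤ p.2 ^ 2 := by positivity
  exact pow_eq_zero_iff (two_ne_zero) |>.mp (by linarith)

/-- The ball lies in a product of `n` discs of radius `ρ` and the interval `[-ρ², ρ²]`, of volume
`(πρ²)^n · 2ρ²`; the exponent is the homogeneous dimension. -/
theorem volume_koranyi_le (n : ℕ) {ρ : ℝ} (hρ : 0 ≤ ρ) :
    volume {p : Hn n | koranyi p ≤ ρ} ≤ ENNReal.ofReal (2 * Real.pi ^ n * ρ ^ (2 * n + 2)) := by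
  have hsub : {p : Hn n | koranyi p ≤ ρ} ⊆
      (Set.univ.pi fun _ => Metric.closedBall (0 : ℂ) ρ) ×ˢ Metric.closedBall (0 : ℝ) (ρ ^ 2) := by
    intro p hp
    have h4 : cnorm p.1 ^ 4 + p.2 ^ 2 ≤ ρ ^ 4 := by
      rw [← koranyi_pow_four]
      exact pow_le_pow_left₀ (koranyi_nonneg p) hp 4
    refine ⟨fun j _ => ?_, ?_⟩
    · rw [mem_closedBall_zero_iff]
      have h5 : cnorm p.1 ≤ ρ := by
        refine le_of_pow_le_pow_left₀ (n := 4) (by norm_num) hρ ?_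
        nlinarith [sq_nonneg p.2]
      refine le_trans (Real.le_sqrt_of_sq_le ?_) h5
      exact Finset.single_le_sum (f := fun j => ‖p.1 j‖ ^ 2) (fun i _ => by positivity)
        (Finset.mem_univ j)
    · rw [mem_closedBall_zero_iff, Real.norm_eq_abs]
      refine abs_le_of_sq_le_sq ?_ (by positivity)
      have : 0 ≤ cnorm p.1 ^ 4 := by positivity
      nlinarith
  refine (measure_mono hsub).trans (le_of_eq ?_)
  rw [Measure.volume_eq_prod, Measure.prod_prod, volume_pi_pi, Real.volume_closedBall]
  simp only [Complex.volume_closedBall, Finset.prod_const, Finset.card_univ, Fintype.card_fin]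
  have : (NNReal.pi : ℝ≥0∞) = ENNReal.ofReal Real.pi := by
    rw [ENNReal.ofReal, ← NNReal.coe_real_pi, Real.toNNReal_coe]
  rw [this, ← ENNReal.ofReal_pow hρ, ← ENNReal.ofReal_mul (by positivity),
    ← ENNReal.ofReal_pow (by positivity), ← ENNReal.ofReal_mul (by positivity)]
  congr 1
  rw [mul_pow]
  ring

/-- The weighted norm `‖|(z,t)|^α f‖₂`. -/
def weightedNorm {n : ℕ} (α : ℝ) (f : Hn n → ℂ) : ℝ≥0∞ :=
  eLpNorm (fun p : Hn n => ((koranyi p ^ α : ℝ) : ℂ) * f p) 2 volume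

theorem eLpNorm_restrict_le_weightedNorm {n : ℕ} {α ρ : ℝ} (hα : 0 < α) (hρ : 0 < ρ)
    (f : Hn n → ℂ) {A : Set (Hn n)} (hA : MeasurableSet A) (h : ∀ p ∈ A, ρ ≤ koranyi p) :
    eLpNorm f 2 (volume.restrict A) ≤ ENNReal.ofReal (ρ ^ (-α)) * weightedNorm α f := by
  have h1 : ∀ᵐ p ∂(volume.restrict A),
      ‖f p‖ ≤ ρ ^ (-α) * ‖((koranyi p ^ α : ℝ) : ℂ) * f p‖ := by
    filter_upwards [ae_restrict_mem hA] with p hp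
    rw [norm_mul, Complex.norm_real, Real.norm_of_nonneg (Real.rpow_nonneg (koranyi_nonneg p) α),
      ← mul_assoc]
    refine le_mul_of_one_le_left (norm_nonneg _) ?_
    rw [Real.rpow_neg hρ.le, inv_mul_eq_div, one_le_div (by positivity)]
    exact Real.rpow_le_rpow hρ.le (h p hp) hα.le
  refine (eLpNorm_le_mul_eLpNorm_of_ae_le_mul h1 2).trans ?_
  exact mul_le_mul_right (eLpNorm_mono_measure _ Measure.restrict_le_self) _

/-- The part of a Korányi ball at positive distance from the origin. -/
def puncturedBall (n : ℕ) (r : ℝ) : Set (Hn n) := {p | 0 < koranyi p ∧ koranyi p ≤ r}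

theorem measurableSet_puncturedBall (n : ℕ) (r : ℝ) : MeasurableSet (puncturedBall n r) :=
  (measurableSet_lt measurable_const measurable_koranyi).inter
    (measurableSet_le measurable_koranyi measurable_const)

/-- Cauchy–Schwarz on the annulus: its volume gives `ρ^{Q/2}`, and the weight, at least `(ρ/2)^α`
there, gives `(ρ/2)^{-α}`. -/
theorem lintegral_annulus_le {n : ℕ} {α ρ : ℝ} (hα : 0 < α) (hρ : 0 < ρ) {f : Hn n → ℂ}
    (hf : AEStronglyMeasurable f) :
    ∫⁻ p in {p | ρ / 2 ≤ koranyi p ∧ koranyi p ≤ ρ}, ‖f p‖ₑ ≤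
      ENNReal.ofReal (2 ^ α * √(2 * Real.pi ^ n) * ρ ^ (homDim n / 2 - α)) * weightedNorm α f := by
  set A : Set (Hn n) := {p | ρ / 2 ≤ koranyi p ∧ koranyi p ≤ ρ} with hAdef
  have hA : MeasurableSet A := (measurableSet_le measurable_const measurable_koranyi).inter
    (measurableSet_le measurable_koranyi measurable_const)
  have h1 : ∫⁻ p in A, ‖f p‖ₑ ≤ eLpNorm f 2 (volume.restrict A) * volume A ^ (1 / 2 : ℝ) := by
    have := eLpNorm_le_eLpNorm_mul_rpow_measure_univ (μ := volume.restrict A) (p := 1) (q := 2)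
      (by norm_num) hf.restrict
    rw [eLpNorm_one_eq_lintegral_enorm, Measure.restrict_apply_univ] at this
    norm_num at this ⊢
    exact this
  have h2 : volume A ^ (1 / 2 : ℝ) ≤ ENNReal.ofReal (√(2 * Real.pi ^ n) * ρ ^ (homDim n / 2)) := by
    have h3 : volume A ≤ _ := (measure_mono fun p hp => hp.2).trans (volume_koranyi_le n hρ.le)
    refine (ENNReal.rpow_le_rpow h3 (by norm_num)).trans (le_of_eq ?_)
    rw [ENNReal.ofReal_rpow_of_nonneg (by positivity) (by norm_num),
      Real.mul_rpow (by positivity) (by positivity), ← Real.sqrt_eq_rpow,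
      ← Real.rpow_natCast ρ, ← Real.rpow_mul hρ.le]
    congr 3
    simp only [homDim]
    push_cast
    ring
  have h3 := eLpNorm_restrict_le_weightedNorm hα (half_pos hρ) f hA fun p hp => hp.1
  refine (h1.trans (mul_le_mul' h3 h2)).trans (le_of_eq ?_)
  rw [mul_right_comm, ← ENNReal.ofReal_mul (by positivity)]
  congr 2
  rw [Real.div_rpow hρ.le (by norm_num), sub_eq_add_neg, Real.rpow_add hρ,
    Real.rpow_neg (by norm_num : (0 : ℝ) ≤ 2)]
  field_simp

/-- The constant in the bound of the `L¹` norm on a Korányi ball by the weighted `L²` norm. -/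
def ballConst (n : ℕ) (α : ℝ) : ℝ :=
  2 ^ α * √(2 * Real.pi ^ n) * (1 - (1 / 2) ^ (homDim n / 2 - α))⁻¹

/-- Dyadic annuli cover the ball except where `koranyi` vanishes, and their bounds form a geometric
series of ratio `2^{-(Q/2-α)}`. This is where `α < Q/2` is needed. -/
theorem lintegral_puncturedBall_le {n : ℕ} {α r : ℝ} (hα : 0 < α) (hα' : α < homDim n / 2)
    (hr : 0 < r) {f : Hn n → ℂ} (hf : AEStronglyMeasurable f) :
    ∫⁻ p in puncturedBall n r, ‖f p‖ₑ ≤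
      ENNReal.ofReal (ballConst n α * r ^ (homDim n / 2 - α)) * weightedNorm α f := by
  set β : ℝ := homDim n / 2 - α with hβ
  have hβ0 : 0 < β := by simp only [hβ]; linarith
  set q : ℝ := (1 / 2) ^ β with hq
  have hq0 : 0 ≤ q := by positivity
  have hq1 : q < 1 := Real.rpow_lt_one (by norm_num) (by norm_num) hβ0
  set c : ℝ := 2 ^ α * √(2 * Real.pi ^ n) with hc
  have hcover : puncturedBall n r ⊆
      ⋃ j : ℕ, {p : Hn n | r * (1 / 2) ^ j / 2 ≤ koranyi p ∧ koranyi p ≤ r * (1 / 2) ^ j} := by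
    rintro p ⟨hp0, hpr⟩
    obtain ⟨j, h1, h2⟩ := exists_nat_pow_near_of_lt_one (x := koranyi p / r) (y := 1 / 2)
      (by positivity) ((div_le_one hr).mpr hpr) (by norm_num) (by norm_num)
    rw [lt_div_iff₀ hr] at h1
    rw [div_le_iff₀ hr] at h2
    refine Set.mem_iUnion.mpr ⟨j, ?_, ?_⟩
    · rw [pow_succ] at h1
      linarith
    · linarith
  calc ∫⁻ p in puncturedBall n r, ‖f p‖ₑ
      ≤ ∑' j : ℕ, ∫⁻ p in {p : Hn n | r * (1 / 2) ^ j / 2 ≤ koranyi p ∧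
          koranyi p ≤ r * (1 / 2) ^ j}, ‖f p‖ₑ :=
        (lintegral_mono_set hcover).trans (lintegral_iUnion_le _ _)
    _ ≤ ∑' j : ℕ, ENNReal.ofReal (c * r ^ β * q ^ j) * weightedNorm α f := by
        refine ENNReal.tsum_le_tsum fun j => ?_
        refine (lintegral_annulus_le hα (by positivity) hf).trans (le_of_eq ?_)
        have e : ((1 / 2 : ℝ) ^ j) ^ β = q ^ j := by
          rw [hq, ← Real.rpow_natCast, ← Real.rpow_natCast, ← Real.rpow_mul (by norm_num),
            ← Real.rpow_mul (by norm_num), mul_comm]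
        rw [Real.mul_rpow hr.le (by positivity), e, ← mul_assoc]
    _ = _ := by
        rw [ENNReal.tsum_mul_right, ← ENNReal.ofReal_tsum_of_nonneg (fun j => by positivity)
          ((summable_geometric_of_lt_one hq0 hq1).mul_left _), tsum_mul_left,
          tsum_geometric_of_lt_one hq0 hq1, ballConst]
        congr 2
        ring

/-- The local estimate at scale `r`: the part of `f` in the ball of radius `r` is estimated by the
`L¹ → L^∞` bound, the rest by the `L²` bound. -/
theorem IsStrichartzL2.lintegral_le {n : ℕ} (hn : 1 ≤ n) {α r : ℝ} (hα : 0 < α)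
    (hα' : α < homDim n / 2) (hr : 0 < r)
    {T : Lp ℂ 2 (volume : Measure (Hn n)) →L[ℂ] Lp ℂ 2 (freqMeasure n)} (hT : IsStrichartzL2 T)
    (E : Set (fan n × Cn n)) (f : Lp ℂ 2 (volume : Measure (Hn n)))
    (hN : weightedNorm α f ≠ ∞) :
    ∫⁻ x in E, ‖T f x‖ₑ ^ 2 ∂(freqMeasure n) ≤
      2 * (ENNReal.ofReal (ballConst n α * r ^ (homDim n / 2 - α)) ^ 2 * freqMeasure n E +
        ENNReal.ofReal (r ^ (-α)) ^ 2) * weightedNorm α f ^ 2 := by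
  set N := weightedNorm α f with hNdef
  set B := puncturedBall n r with hB
  have hBm : MeasurableSet B := measurableSet_puncturedBall n r
  have hfm := Lp.memLp f
  have hm1 : MemLp (B.indicator f) 2 volume := hfm.indicator hBm
  have hm2 : MemLp (Bᶜ.indicator f) 2 volume := hfm.indicator hBm.compl
  set f₁ := hm1.toLp _ with hf₁
  set f₂ := hm2.toLp _ with hf₂
  have hsplit : f = f₁ + f₂ := by
    rw [hf₁, hf₂, ← MemLp.toLp_add]
    conv_lhs => rw [← Lp.toLp_coeFn f hfm]
    rw [MemLp.toLp_eq_toLp_iff, Set.indicator_self_add_compl]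
  have hL1 : ∫⁻ p, ‖B.indicator f p‖ₑ ≤
      ENNReal.ofReal (ballConst n α * r ^ (homDim n / 2 - α)) * N := by
    simp_rw [enorm_indicator_eq_indicator_enorm]
    rw [lintegral_indicator hBm]
    exact lintegral_puncturedBall_le hα hα' hr hfm.1
  have hi : Integrable (B.indicator f) volume :=
    ⟨hm1.1, hL1.trans_lt (ENNReal.mul_lt_top ENNReal.ofReal_lt_top hN.lt_top)⟩
  have hi1 : Integrable (f₁ : Hn n → ℂ) volume := hi.congr hm1.coeFn_toLp.symm
  have hT1 : ∀ᵐ x ∂(freqMeasure n), ‖T f₁ x‖ₑ ≤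
      ENNReal.ofReal (ballConst n α * r ^ (homDim n / 2 - α)) * N := by
    filter_upwards [hT f₁ hi1, ae_fst_ne_zero n] with x hx hx0
    rw [hx, normStrichartz_congr hm1.coeFn_toLp x, ← ofReal_norm]
    refine (ENNReal.ofReal_le_ofReal (norm_normStrichartz_le hn hi x hx0)).trans ?_
    rw [ofReal_integral_norm_eq_lintegral_enorm hi]
    exact hL1
  have hT2 : ∫⁻ x, ‖T f₂ x‖ₑ ^ 2 ∂(freqMeasure n) ≤ ENNReal.ofReal (r ^ (-α)) ^ 2 * N ^ 2 := by
    have h1 : eLpNorm (T f₂) 2 (freqMeasure n) ≤ ENNReal.ofReal (r ^ (-α)) * N := by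
      have h2 : eLpNorm (T f₂) 2 (freqMeasure n) ≤ eLpNorm f₂ 2 volume := by
        have := hT.norm_apply_le hn f₂
        rwa [Lp.norm_def, Lp.norm_def,
          ENNReal.toReal_le_toReal (Lp.eLpNorm_ne_top _) (Lp.eLpNorm_ne_top _)] at this
      -- The complement of the punctured ball contains the zero set of `koranyi`, where the weight
      -- gives no control; that set is null.
      have hC : (Bᶜ : Set (Hn n)) =ᵐ[volume] {p | r ≤ koranyi p ∧ p ∈ Bᶜ} := by
        filter_upwards [koranyi_pos_ae n] with p hp
        refine propext ⟨fun h => ⟨?_, h⟩, fun h => h.2⟩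
        exact le_of_lt (not_le.mp fun hle => h ⟨hp, hle⟩)
      refine h2.trans ?_
      rw [eLpNorm_congr_ae hm2.coeFn_toLp, eLpNorm_indicator_eq_eLpNorm_restrict hBm.compl,
        Measure.restrict_congr_set hC]
      exact eLpNorm_restrict_le_weightedNorm hα hr f
        ((measurableSet_le measurable_const measurable_koranyi).inter hBm.compl) fun p hp => hp.1
    rw [← mul_pow]
    refine le_trans (le_of_eq ?_) (pow_le_pow_left' h1 2)
    have := eLpNorm_nnreal_pow_eq_lintegral (f := T f₂) (μ := freqMeasure n) (p := 2) (by norm_num)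
    simpa using this.symm
  have hadd : ∀ᵐ x ∂(freqMeasure n), ‖T f x‖ₑ ^ 2 ≤ 2 * (‖T f₁ x‖ₑ ^ 2 + ‖T f₂ x‖ₑ ^ 2) := by
    have e : T f = T f₁ + T f₂ := by rw [hsplit, map_add]
    rw [e]
    filter_upwards [Lp.coeFn_add (T f₁) (T f₂)] with x hx
    rw [hx, Pi.add_apply]
    refine (pow_le_pow_left' (enorm_add_le _ _) 2).trans ?_
    have := two_mul_enorm_mul_le (T f₁ x) (T f₂ x)
    calc (‖T f₁ x‖ₑ + ‖T f₂ x‖ₑ) ^ 2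
        = ‖T f₁ x‖ₑ ^ 2 + ‖T f₂ x‖ₑ ^ 2 + 2 * (‖T f₁ x‖ₑ * ‖T f₂ x‖ₑ) := by ring
      _ ≤ ‖T f₁ x‖ₑ ^ 2 + ‖T f₂ x‖ₑ ^ 2 + (‖T f₁ x‖ₑ ^ 2 + ‖T f₂ x‖ₑ ^ 2) := by gcongr
      _ = _ := by ring
  calc ∫⁻ x in E, ‖T f x‖ₑ ^ 2 ∂(freqMeasure n)
      ≤ ∫⁻ x in E, 2 * ((ENNReal.ofReal (ballConst n α * r ^ (homDim n / 2 - α)) * N) ^ 2 +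
          ‖T f₂ x‖ₑ ^ 2) ∂(freqMeasure n) := by
        refine lintegral_mono_ae (ae_restrict_of_ae ?_)
        filter_upwards [hadd, hT1] with x h1 h2
        exact h1.trans (by gcongr)
    _ ≤ 2 * ((ENNReal.ofReal (ballConst n α * r ^ (homDim n / 2 - α)) * N) ^ 2 * freqMeasure n E +
          ENNReal.ofReal (r ^ (-α)) ^ 2 * N ^ 2) := by
        rw [lintegral_const_mul' _ _ (by norm_num), lintegral_add_left measurable_const,
          lintegral_const, Measure.restrict_apply_univ]
        gcongr
        exact (setLIntegral_le_lintegral _ _).trans hT2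
    _ = _ := by rw [mul_pow]; ring

end Heisenberg

end

/-! ### The main theorem: degenerate cases and the choice of scale. -/

theorem mainTheorem5 (n : ℕ) (hn : 1 ≤ n) (α : ℝ) (hα0 : 0 < α)
    (hα : α < Heisenberg.homDim n / 2) :
    (∃! T : Lp ℂ 2 (volume : Measure (Heisenberg.Hn n)) →L[ℂ]
        Lp ℂ 2 (Heisenberg.freqMeasure n), Heisenberg.IsStrichartzL2 T) ∧
    ∃ C : ℝ, 0 < C ∧
      ∀ T : Lp ℂ 2 (volume : Measure (Heisenberg.Hn n)) →L[ℂ]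
          Lp ℂ 2 (Heisenberg.freqMeasure n), Heisenberg.IsStrichartzL2 T →
      ∀ (E : Set (Heisenberg.fan n × Heisenberg.Cn n))
        (f : Lp ℂ 2 (volume : Measure (Heisenberg.Hn n))),
        ∫⁻ x in E, ‖T f x‖ₑ ^ 2 ∂(Heisenberg.freqMeasure n) ≤
          ENNReal.ofReal C * Heisenberg.freqMeasure n E ^ (2 * α / Heisenberg.homDim n) *
            eLpNorm (fun p : Heisenberg.Hn n =>
              ((Heisenberg.koranyi p ^ α : ℝ) : ℂ) * f p) 2 volume ^ 2 := by
  obtain ⟨T₀, hT₀⟩ := Heisenberg.exists_isStrichartzL2 hn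
  refine ⟨⟨T₀, hT₀, fun S hS => hS.unique hn hT₀⟩, 2 * (Heisenberg.ballConst n α ^ 2 + 1),
    by positivity, fun T hT E f => ?_⟩
  change _ ≤ _ * Heisenberg.weightedNorm α f ^ 2
  have hQ : 0 < Heisenberg.homDim n := by simp only [Heisenberg.homDim]; positivity
  have hexp : 0 < 2 * α / Heisenberg.homDim n := by positivity
  by_cases hE0 : Heisenberg.freqMeasure n E = 0
  · rw [Measure.restrict_eq_zero.mpr hE0]
    simp
  by_cases hN : Heisenberg.weightedNorm α f = ∞
  · rw [hN]
    have h1 : Heisenberg.freqMeasure n E ^ (2 * α / Heisenberg.homDim n) ≠ 0 := by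
      simp [ENNReal.rpow_eq_zero_iff, hE0, hexp.not_gt]
    have h2 : ENNReal.ofReal (2 * (Heisenberg.ballConst n α ^ 2 + 1)) ≠ 0 := by
      rw [Ne, ENNReal.ofReal_eq_zero, not_le]
      positivity
    rw [ENNReal.top_pow (by norm_num), ENNReal.mul_top (mul_ne_zero h2 h1)]
    exact le_top
  by_cases hE : Heisenberg.freqMeasure n E = ∞
  -- With `|E| = ∞` and vanishing weighted norm the right side is `∞ · 0 = 0`, so the left side must
  -- be shown to vanish; the local estimate at any scale, here `r = 1`, does this.
  · by_cases hN0 : Heisenberg.weightedNorm α f = 0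
    · have := hT.lintegral_le hn hα0 hα one_pos E f hN
      rw [hN0] at this ⊢
      simpa using this
    · rw [hE, ENNReal.top_rpow_of_pos hexp, ENNReal.mul_top, ENNReal.top_mul (pow_ne_zero _ hN0)]
      · exact le_top
      · rw [Ne, ENNReal.ofReal_eq_zero, not_le]
        positivity
  set m : ℝ := (Heisenberg.freqMeasure n E).toReal with hm
  have hm0 : 0 < m := ENNReal.toReal_pos hE0 hE
  have hEm : Heisenberg.freqMeasure n E = ENNReal.ofReal m := (ENNReal.ofReal_toReal hE).symm
  set Q := Heisenberg.homDim n with hQdef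
  -- The scale that balances the two terms: `r^{Q-2α} m` and `r^{-2α}` both equal `m^{2α/Q}`, whence
  -- the constant `2 * (ballConst n α ^ 2 + 1)`.
  set r : ℝ := m ^ (-(1 / Q)) with hr
  have hr0 : 0 < r := by positivity
  refine (hT.lintegral_le hn hα0 hα hr0 E f hN).trans (le_of_eq ?_)
  congr 1
  have e1 : (r ^ (Q / 2 - α)) ^ 2 * m = m ^ (2 * α / Q) := by
    rw [hr, ← Real.rpow_natCast, ← Real.rpow_mul hm0.le, ← Real.rpow_mul hm0.le]
    nth_rewrite 2 [← Real.rpow_one m]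
    rw [← Real.rpow_add hm0]
    congr 1
    field_simp
    push_cast
    ring
  have e2 : (r ^ (-α)) ^ 2 = m ^ (2 * α / Q) := by
    rw [hr, ← Real.rpow_natCast, ← Real.rpow_mul hm0.le, ← Real.rpow_mul hm0.le]
    congr 1
    field_simp
    push_cast
    ring
  rw [hEm, ENNReal.ofReal_rpow_of_pos hm0, ← ENNReal.ofReal_mul (by positivity)]
  have hb : 0 ≤ Heisenberg.ballConst n α := by
    unfold Heisenberg.ballConst
    have : ((1 : ℝ) / 2) ^ (Heisenberg.homDim n / 2 - α) ≤ 1 :=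
      Real.rpow_le_one (by norm_num) (by norm_num) (by linarith)
    have := inv_nonneg.mpr (sub_nonneg.mpr this)
    positivity
  rw [← ENNReal.ofReal_pow (by positivity), ← ENNReal.ofReal_pow (by positivity),
    ← ENNReal.ofReal_mul (by positivity), ← ENNReal.ofReal_add (by positivity) (by positivity),
    show (2 : ℝ≥0∞) = ENNReal.ofReal 2 by norm_num, ← ENNReal.ofReal_mul (by norm_num)]
  congr 1
  rw [mul_pow, mul_assoc (Heisenberg.ballConst n α ^ 2), e1, e2]
  ring
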